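/- Let $H$ and $X$ be real separable Hilbert spaces, with $H$ embedded in $X$ densely and injectively by a Hilbert--Schmidt map $\iota\colon H\hookrightarrow X$, and set $\mathbb C:=\iota\iota^*\colon X\to X$. Let $W\subset H$ be a finite-dimensional subspace and $\mathbb P$ the orthogonal projection of $H$ onto $W$. Let $(\Xi_n)_{n\ge1}$ be an increasing sequence of subspaces of $W^\perp\subset H$ with $\dim\Xi_n=n$ and $\overline{\bigcup_n\Xi_n}^{\,H}=W^\perp$. For $\beta>0$ let $\gamma_\beta=\mathcal N_X(0,\beta^{-1}\mathbb C)$ be the centered Gaussian measure on $X$ with covariance operator $\beta^{-1}\mathbb C$. Let $\widehat{\mathbb P}\colon X\to W$ be a measurable linear extension of $\mathbb P$, i.e. a map measurable with respect to the $\gamma_\beta$-completion of the Borel $\sigma$-algebra that is linear on a subspace $L\subset X$ with $H\subset L$ and $\gamma_\beta(L)=1$ and coincides with $\mathbb P$ on $H$; and let $\widehat{\mathbb Q}:=\mathrm{id}-\widehat{\mathbb P}\colon X\to X$. For $\beta>0$, $e\in\mathbb R$ and $n\geq1$ let $\zeta_{\beta,n,e}$ be the locally finite measure on $\Xi_n$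 such that, for all $\varphi\in C_c(\Xi_n)$, $$\int_{\Xi_n}\varphi\,d\zeta_{\beta,n,e}=\lim_{h\downarrow0}\frac1h\int_{\Xi_n}\varphi(\xi)\,\mathbf 1\Big\{\tfrac n{2\beta}+e\le\tfrac12\|\xi\|_H^2<\tfrac n{2\beta}+e+h\Big\}\,d\xi ,$$ where $d\xi$ is the Lebesgue measure on $\Xi_n$, and let $\mathsf Z_{\beta,n,e}:=\zeta_{\beta,n,e}(\Xi_n)$. The measure $\gamma_\beta$ and a map $\widehat{\mathbb P}$ exist. Whenever $\frac n{2\beta}+e>0$ (hence for all large $n$), the measure $\zeta_{\beta,n,e}$ exists and $0<\mathsf Z_{\beta,n,e}<\infty$. 1. There exist numbers $C(\beta,n)$, depending only on $\beta$ and $n$, such that $|C(\beta,n)|\to\infty$ as $n\to\infty$ for every $\beta>0$ (more precisely $C(\beta,n)\to+\infty$ if $\beta<2\pi\mathrm e$ and $C(\beta,n)\to-\infty$ if $\beta\ge2\pi\mathrm e$, where $\mathrm e=\exp(1)$), and such that for all $\beta>0$ and $e\in\mathbb R$ $$\log\mathsf Z_{\beta,n,e}-C(\beta,n)\longrightarrow\beta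 e\qquad\text{as }n\to\infty.$$ 2. For all $\beta>0$, $e\in\mathbb R$ and every such $\widehat{\mathbb P}$, the normalized measures $\mathsf Z_{\beta,n,e}^{-1}\,\zeta_{\beta,n,e}$, considered as measures on $X$, converge narrowly on $X$ (in duality with $C_b(X)$) to the push-forward $\widehat{\mathbb Q}_\#\gamma_\beta$, which is a probability measure, as $n\to\infty$. -/

import Mathlib

open MeasureTheory ProbabilityTheory Filter Topology

noncomputable section

namespace Microcanonical

/-- `IsDelta f a μ`: the locally finite measure `μ` is the measure `δ[f(x) - a](dx)`, i.e. for all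
`φ ∈ C_c(E)`, `∫ φ dμ = lim_{h ↓ 0} (1/h) ∫ φ(x) 1{a ≤ f(x) < a + h} dx`, where `dx` is the
Lebesgue measure of the finite-dimensional Euclidean space `E`. -/
structure IsDelta {E : Type*} [NormedAddCommGroup E] [InnerProductSpace ℝ E]
    [FiniteDimensional ℝ E] [MeasurableSpace E] [BorelSpace E]
    (f : E → ℝ) (a : ℝ) (μ : Measure E) : Prop where
  locallyFinite : IsLocallyFiniteMeasure μ
  tendsto : ∀ φ : E → ℝ, Continuous φ → HasCompactSupport φ →
    Tendsto (fun h : ℝ => h⁻¹ * ∫ x in {x | a ≤ f x ∧ f x < a + h}, φ x) (𝓝[>] 0)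
      (𝓝 (∫ x, φ x ∂μ))

open Classical in
/-- The measure `δ[f(x) - a](dx)` on `E` (it is determined by its defining property), with value
`0` if the limits that define it do not exist. -/
def delta {E : Type*} [NormedAddCommGroup E] [InnerProductSpace ℝ E]
    [FiniteDimensional ℝ E] [MeasurableSpace E] [BorelSpace E]
    (f : E → ℝ) (a : ℝ) : Measure E :=
  if h : ∃ μ : Measure E, IsDelta f a μ then h.choose else 0

/-- The microcanonical measure `δ[‖ξ‖²/2 - n/(2β) - e](dξ)`, to be used on a Euclidean space `E` of
dimension `n`. -/
def microcanonical (E : Type*) [NormedAddCommGroup E] [InnerProductSpace ℝ E]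
    [FiniteDimensional ℝ E] [MeasurableSpace E] [BorelSpace E] (β : ℝ) (n : ℕ) (e : ℝ) :
    Measure E :=
  delta (fun ξ : E => ‖ξ‖ ^ 2 / 2) (n / (2 * β) + e)

/-- A bounded operator between Hilbert spaces is Hilbert–Schmidt if `∑ ‖T bₖ‖² < ∞` for some
(equivalently, every) orthonormal basis `b`. -/
def IsHilbertSchmidt {H X : Type*} [NormedAddCommGroup H] [InnerProductSpace ℝ H]
    [NormedAddCommGroup X] [InnerProductSpace ℝ X] (T : H →L[ℝ] X) : Prop :=
  ∃ (s : Set H) (b : HilbertBasis s ℝ H), Summable fun k => ‖T (b k)‖ ^ 2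

/-- `γ = N_X(0, R)`: the centered Gaussian measure with covariance operator `R`; every `⟪x, η⟫` with
`η ∼ γ` is a centered real Gaussian variable with variance `⟪R x, x⟫`. -/
def IsCenteredGaussian {X : Type*} [NormedAddCommGroup X] [InnerProductSpace ℝ X]
    [MeasurableSpace X] (R : X →L[ℝ] X) (γ : Measure X) : Prop :=
  ∀ x : X, γ.map (fun η => inner ℝ x η) = gaussianReal 0 (Real.toNNReal (inner ℝ (R x) x))

/-- The covariance operator `β⁻¹ ι ι*` on `X` of the canonical Gaussian measure at inverse
temperature `β` attached to the embedding `ι : H → X`. -/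
def canonicalCov {H X : Type*} [NormedAddCommGroup H] [InnerProductSpace ℝ H] [CompleteSpace H]
    [NormedAddCommGroup X] [InnerProductSpace ℝ X] [CompleteSpace X] (ι : H →L[ℝ] X) (β : ℝ) :
    X →L[ℝ] X :=
  β⁻¹ • (ι ∘L ContinuousLinearMap.adjoint ι)

/-- `g` is a measurable linear extension of `f : H → Y` to `X ⊇ ι(H)`: it is measurable with respect
to the `γ`-completed Borel σ-algebra, it is linear on a linear subspace `L ⊇ ι(H)` of full
`γ`-measure, and it coincides with `f` on `H`. (The values of `g` outside `L` are irrelevant.) -/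
structure IsMeasurableLinearExtension {H X Y : Type*} [NormedAddCommGroup H]
    [InnerProductSpace ℝ H] [NormedAddCommGroup X] [InnerProductSpace ℝ X] [MeasurableSpace X]
    [NormedAddCommGroup Y] [NormedSpace ℝ Y] [MeasurableSpace Y]
    (ι : H →L[ℝ] X) (γ : Measure X) (f : H →L[ℝ] Y) (g : X → Y) : Prop where
  nullMeasurable : NullMeasurable g γ
  exists_linear : ∃ (L : Submodule ℝ X) (G : L →ₗ[ℝ] Y),
    γ (L : Set X)ᶜ = 0 ∧ (∀ h : H, ι h ∈ L) ∧ ∀ x : L, g x = G x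
  extends_map : ∀ h : H, g (ι h) = f h

end Microcanonical

end

/-! Put `a = n/(2β) + e`. The density defining the microcanonical measure is radial, so the measure
is a multiple of the uniform law on the sphere of radius `√(2a)`. Its mass is the derivative of the
ball volume `ω_n (2a)^(n/2)`, that is `n ω_n (2a)^(n/2-1)` (`isDelta_uniformSphere`).

Dividing by the mass at `e = 0` leaves `(1 + 2βe/n)^(n/2-1)`, which tends to `exp(βe)`. So `C(β,n)`
can be the logarithm of the mass at `e = 0`. Stirling gives `(n/2) log(2πe/β) - (log n)/2 + O(1)`
with `e = exp 1`; the second term decides the borderline case.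

For the narrow limit, the uniform law on a sphere is the law of a normalized Gaussian vector. With
one i.i.d. sequence `ω` and an orthonormal sequence `f` adapted to the `Ξ n`, the normalized measure
on `X` is the law of `(√(2a) / √(∑ ω_k²)) ∑ ω_k ι(f_k)`, sums over `k < n`. The scalar tends to
`β^(-1/2)` by the law of large numbers, and the series converges in `L²` because `ι` is
Hilbert–Schmidt. The limit is Gaussian with variances `β⁻¹ ‖Q ι* v‖²`, where `Q` projects onto `Wᗮ`.

The push-forward of `γ` has the same marginals: this is computed for one extension of the
projection, built as an almost sure limit of continuous maps, and passes to all others because a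
zero-one law, derived from Cameron–Martin, makes extensions almost surely unique. -/

noncomputable section

namespace Microcanonical

/-! ### Polar coordinates and the uniform law on the sphere -/

section UniformSphere

variable (E : Type*) [NormedAddCommGroup E] [InnerProductSpace ℝ E]
    [FiniteDimensional ℝ E] [MeasurableSpace E] [BorelSpace E]

/-- The uniform probability measure on the unit sphere, as a measure on the whole space. -/
def uniformSphere : Measure E :=
  (((volume : Measure E).toSphere Set.univ)⁻¹ • (volume : Measure E).toSphere).map Subtype.val

instance isProbabilityMeasure_uniformSphere [Nontrivial E] :
    IsProbabilityMeasure (uniformSphere E) := by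
  constructor
  rw [uniformSphere, Measure.map_apply measurable_subtype_coe .univ, Measure.smul_apply,
    Set.preimage_univ, smul_eq_mul]
  exact ENNReal.inv_mul_cancel (Measure.measure_univ_ne_zero.2 (Measure.toSphere_ne_zero _))
    (measure_ne_top _ _)

variable {E}

/-- In polar coordinates Lebesgue measure is a product measure and the integrand is a product, so
Tonelli applies. -/
lemma lintegral_polar [Nontrivial E] {f : ℝ → ENNReal} (hf : Measurable f)
    {g : E → ENNReal} (hg : Measurable g) :
    ∫⁻ x : E, f ‖x‖ * g (‖x‖⁻¹ • x) =
      (∫⁻ s, g s ∂(volume : Measure E).toSphere) *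
        ∫⁻ r, f r ∂(Measure.volumeIoiPow (Module.finrank ℝ E - 1)) := by
  have h := (Measure.measurePreserving_homeomorphUnitSphereProd (volume : Measure E)).lintegral_comp
    (f := fun p => g p.1 * f p.2) (by fun_prop)
  rw [← setLIntegral_univ, ← lintegral_prod_mul (by fun_prop) (by fun_prop), ← h, setLIntegral_univ]
  -- The origin is null; polar coordinates only parametrize its complement.
  conv_lhs => rw [← restrict_compl_singleton (μ := (volume : Measure E)) 0,
    ← lintegral_subtype_comap (measurableSet_singleton (0 : E)).compl]
  refine lintegral_congr fun x => ?_
  simp [mul_comm]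

/-- Under a radial density the direction is uniform, whatever the profile. The Gaussian profile and
the indicator of a shell are the two uses. -/
theorem map_normalize_withDensity [Nontrivial E] {f : ℝ → ENNReal} (hf : Measurable f) :
    ((volume : Measure E).withDensity fun x => f ‖x‖).map (fun x => ‖x‖⁻¹ • x) =
      (∫⁻ x : E, f ‖x‖) • uniformSphere E := by
  have hm : Measurable fun x : E => ‖x‖⁻¹ • x := by fun_prop
  refine Measure.ext_of_lintegral _ fun g hg => ?_
  rw [lintegral_map hg hm, lintegral_withDensity_eq_lintegral_mul _ (by fun_prop) (by fun_prop)]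
  simp only [Pi.mul_apply]
  have h1 := lintegral_polar (E := E) hf (g := fun _ => 1) measurable_const
  simp only [mul_one, lintegral_const, one_mul] at h1
  rw [lintegral_polar hf hg, h1, lintegral_smul_measure, uniformSphere,
    lintegral_map hg measurable_subtype_coe, lintegral_smul_measure, smul_eq_mul, smul_eq_mul]
  have h2 : (volume : Measure E).toSphere Set.univ ≠ 0 := 
    Measure.measure_univ_ne_zero.2 (Measure.toSphere_ne_zero _)
  have h3 := ENNReal.mul_inv_cancel h2 (measure_ne_top _ _)
  calc _ = ((volume : Measure E).toSphere Set.univ * ((volume : Measure E).toSphere Set.univ)⁻¹) *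
        ((∫⁻ s, g s ∂(volume : Measure E).toSphere) *
        ∫⁻ r, f r ∂(Measure.volumeIoiPow (Module.finrank ℝ E - 1))) := by rw [h3, one_mul]
    _ = _ := by ring

/-- The law of the direction of a standard Gaussian vector is uniform. -/
theorem map_normalize_stdGaussian [Nontrivial E] :
    (stdGaussian E).map (fun x => ‖x‖⁻¹ • x) = uniformSphere E := by
  set c : ℝ := (2 * Real.pi) ^ (-(Module.finrank ℝ E / 2 : ℝ)) with hc
  have hc0 : 0 < c := by positivity
  set f : ℝ → ENNReal := fun r => ENNReal.ofReal (c * Real.exp (-(r ^ 2 / 2))) with hf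
  have hfm : Measurable f := by fun_prop
  set ν := (volume : Measure E).withDensity fun x => f ‖x‖ with hν
  -- The Gaussian density is matched with `stdGaussian` through characteristic functions; its total
  -- mass `1` is then read off from this equality.
  have hchar : ∀ t : E, charFun ν t = Complex.exp (-(‖t‖ ^ 2 / 2)) := by
    intro t
    have := GaussianFourier.integral_cexp_neg_mul_sq_norm_add (V := E) (b := 1 / 2)
      (by norm_num) Complex.I t
    rw [charFun_apply, hν, integral_withDensity_eq_integral_toReal_smul (by fun_prop)
      (by simp [hf])]
    have hb : (Real.pi / (1 / 2) : ℂ) ^ (Module.finrank ℝ E / 2 : ℂ) = (c : ℂ)⁻¹ := by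
      rw [hc, Real.rpow_neg (by positivity), Complex.ofReal_inv, inv_inv, Complex.ofReal_cpow
        (by positivity)]
      push_cast
      congr 1
      ring
    have hc' : (c : ℂ) ≠ 0 := by exact_mod_cast hc0.ne'
    calc _ = ∫ x : E, (c : ℂ) * Complex.exp (-(1 / 2) * ‖x‖ ^ 2 + Complex.I * inner ℝ t x) := by
          refine integral_congr_ae (ae_of_all _ fun x => ?_)
          simp only [hf]
          rw [ENNReal.toReal_ofReal (by positivity), Complex.exp_add, Complex.real_smul,
            real_inner_comm]
          push_cast
          rw [show (-((‖x‖ : ℂ) ^ 2 / 2)) = -(1 / 2) * ‖x‖ ^ 2 by ring, mul_assoc, mul_comm Complex.I]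
      _ = _ := by
          rw [integral_const_mul, this, hb, ← mul_assoc, mul_inv_cancel₀ hc', one_mul, Complex.I_sq]
          congr 1
          ring
  have hfin : IsFiniteMeasure ν := by
    have hi : Integrable fun x : E => c * Real.exp (-(‖x‖ ^ 2 / 2)) := by
      have := (GaussianFourier.integrable_cexp_neg_mul_sq_norm_add (V := E) (b := 1 / 2)
        (by norm_num) 0 0).re.const_mul c
      refine this.congr (ae_of_all _ fun x => ?_)
      simp only [zero_mul, add_zero]
      rw [show (-(1 / 2) * (‖x‖ : ℂ) ^ 2) = ((-(‖x‖ ^ 2 / 2) : ℝ) : ℂ) by push_cast; ring,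
        ← Complex.ofReal_exp, RCLike.re_eq_complex_re, Complex.ofReal_re]
    constructor
    rw [hν, withDensity_apply _ .univ, setLIntegral_univ]
    exact hi.lintegral_lt_top
  have : ν = stdGaussian E := by
    refine Measure.ext_of_charFun ?_
    ext t
    rw [hchar, charFun_stdGaussian, neg_div]
  have h2 := map_normalize_withDensity (E := E) hfm
  rw [← hν, this] at h2
  have h3 : ∫⁻ x : E, f ‖x‖ = 1 := by
    have : ν Set.univ = 1 := by rw [this]; simp
    simpa [hν] using this
  rw [h2, h3, one_smul]

end UniformSphere

/-! ### The microcanonical measure as a multiple of the uniform law on a sphere -/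

/-- The volume of the unit ball in dimension `n`. -/
def unitBallVolume (n : ℕ) : ℝ := √Real.pi ^ n / Real.Gamma (n / 2 + 1)

lemma unitBallVolume_pos (n : ℕ) : 0 < unitBallVolume n :=
  div_pos (pow_pos (Real.sqrt_pos.2 Real.pi_pos) _) (Real.Gamma_pos_of_pos (by positivity))

/-- The total mass of `δ[‖x‖²/2 - a](dx)` in dimension `n`. -/
def shellMass (n : ℕ) (a : ℝ) : ℝ := n * unitBallVolume n * (2 * a) ^ (n / 2 - 1 : ℝ)

lemma shellMass_pos {n : ℕ} (hn : 1 ≤ n) {a : ℝ} (ha : 0 < a) : 0 < shellMass n a := by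
  have := unitBallVolume_pos n
  unfold shellMass
  positivity

section Delta

variable {E : Type*} [NormedAddCommGroup E] [InnerProductSpace ℝ E]
    [FiniteDimensional ℝ E] [MeasurableSpace E] [BorelSpace E]

variable (E) in
/-- The spherical shell `a ≤ ‖x‖²/2 < a + h`. -/
def shell (a h : ℝ) : Set E := {x | a ≤ ‖x‖ ^ 2 / 2 ∧ ‖x‖ ^ 2 / 2 < a + h}

omit [InnerProductSpace ℝ E] [FiniteDimensional ℝ E] in
lemma measurableSet_shell (a h : ℝ) : MeasurableSet (shell E a h) :=
  (by fun_prop : Measurable fun x : E => ‖x‖ ^ 2 / 2) measurableSet_Ico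

lemma volume_ball_sqrt [Nontrivial E] {a : ℝ} (ha : 0 < a) :
    volume (Metric.ball (0 : E) √(2 * a)) =
      ENNReal.ofReal (unitBallVolume (Module.finrank ℝ E) *
        (2 * a) ^ (Module.finrank ℝ E / 2 : ℝ)) := by
  rw [InnerProductSpace.volume_ball, ← ENNReal.ofReal_pow (Real.sqrt_nonneg _),
    ← ENNReal.ofReal_mul (by positivity), mul_comm, Real.sqrt_eq_rpow (2 * a),
    ← Real.rpow_natCast ((2 * a) ^ (1 / 2 : ℝ)), ← Real.rpow_mul (by positivity), unitBallVolume,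
    one_div_mul_eq_div]

lemma volume_shell [Nontrivial E] {a h : ℝ} (ha : 0 < a) (hh : 0 < h) :
    volume (shell E a h) = ENNReal.ofReal (unitBallVolume (Module.finrank ℝ E) *
      ((2 * (a + h)) ^ (Module.finrank ℝ E / 2 : ℝ) - (2 * a) ^ (Module.finrank ℝ E / 2 : ℝ))) := by
  have h1 : shell E a h = Metric.ball 0 √(2 * (a + h)) \ Metric.ball 0 √(2 * a) := by
    ext x
    simp only [shell, Set.mem_ofPred_eq, Set.mem_sdiff, mem_ball_zero_iff, not_lt,
      Real.lt_sqrt (norm_nonneg x)]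
    constructor <;> rintro ⟨h1, h2⟩ <;> constructor <;> linarith
  rw [h1, measure_sdiff (Metric.ball_subset_ball (Real.sqrt_le_sqrt (by linarith)))
    measurableSet_ball.nullMeasurableSet measure_ball_lt_top.ne, volume_ball_sqrt ha,
    volume_ball_sqrt (by linarith : 0 < a + h), ← ENNReal.ofReal_sub _
    (mul_nonneg (unitBallVolume_pos _).le (by positivity)), mul_sub]

/-- The shell is a difference of two balls, so this is the derivative of `t ↦ ω_n (2t)^(n/2)` at
`a`. -/
lemma tendsto_volume_shell [Nontrivial E] {a : ℝ} (ha : 0 < a) :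
    Tendsto (fun h => h⁻¹ * volume.real (shell E a h)) (𝓝[>] 0)
      (𝓝 (shellMass (Module.finrank ℝ E) a)) := by
  set n := Module.finrank ℝ E
  have hd : HasDerivAt (fun t : ℝ => unitBallVolume n * (2 * t) ^ (n / 2 : ℝ)) (shellMass n a) a := by
    have := (((hasDerivAt_id a).const_mul 2).rpow_const (p := (n / 2 : ℝ))
      (Or.inl (by simpa using ha.ne'))).const_mul (unitBallVolume n)
    refine this.congr_deriv ?_
    simp only [shellMass, id]
    ring
  have h2 := hd.tendsto_slope_zero_right
  refine h2.congr' ?_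
  filter_upwards [self_mem_nhdsWithin] with h hh
  have hh : 0 < h := hh
  have h0 : (2 * a) ^ (n / 2 : ℝ) ≤ (2 * (a + h)) ^ (n / 2 : ℝ) :=
    Real.rpow_le_rpow (by positivity) (by linarith) (by positivity)
  rw [measureReal_def, volume_shell ha hh, ENNReal.toReal_ofReal
    (mul_nonneg (unitBallVolume_pos _).le (sub_nonneg.2 h0)), smul_eq_mul]
  ring

lemma setIntegral_shell_comp_normalize [Nontrivial E] (a h : ℝ) {ψ : E → ℝ} (hψ : Continuous ψ) :
    ∫ x in shell E a h, ψ (‖x‖⁻¹ • x) =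
      volume.real (shell E a h) * ∫ x, ψ x ∂(uniformSphere E) := by
  set S : Set ℝ := {r | a ≤ r ^ 2 / 2 ∧ r ^ 2 / 2 < a + h}
  have hS : MeasurableSet S :=
    (by fun_prop : Measurable fun x : ℝ => x ^ 2 / 2) measurableSet_Ico
  have h1 := map_normalize_withDensity (E := E) (f := S.indicator 1)
    (measurable_one.indicator hS)
  have h2 : (fun x : E => S.indicator (1 : ℝ → ENNReal) ‖x‖) = (shell E a h).indicator 1 := by
    ext x
    by_cases hx : x ∈ shell E a h
    · rw [Set.indicator_of_mem hx, Set.indicator_of_mem (show ‖x‖ ∈ S from hx)]; rfl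
    · rw [Set.indicator_of_notMem hx, Set.indicator_of_notMem (show ‖x‖ ∉ S from hx)]
  rw [h2, withDensity_indicator_one (measurableSet_shell a h),
    lintegral_indicator_one (measurableSet_shell a h)] at h1
  rw [← integral_map (φ := fun x : E => ‖x‖⁻¹ • x) (by fun_prop) hψ.aestronglyMeasurable, h1,
    integral_smul_measure]
  rfl

/-- On a thin shell, `φ` is uniformly close to its value at the radial projection onto the inner
sphere. The integral of the latter factors exactly into shell volume times spherical mean. -/
theorem isDelta_uniformSphere [Nontrivial E] {a : ℝ} (ha : 0 < a) :
    IsDelta (fun x : E => ‖x‖ ^ 2 / 2) a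
      (ENNReal.ofReal (shellMass (Module.finrank ℝ E) a) •
        (uniformSphere E).map (fun x => √(2 * a) • x)) where
  locallyFinite := by
    have : IsFiniteMeasure (ENNReal.ofReal (shellMass (Module.finrank ℝ E) a) •
        (uniformSphere E).map (fun x => √(2 * a) • x)) :=
      Measure.smul_finite _ ENNReal.ofReal_ne_top
    infer_instance
  tendsto φ hφ hc := by
    set n := Module.finrank ℝ E with hn
    set r := √(2 * a) with hr
    have hn1 : 1 ≤ n := Module.finrank_pos
    set I := ∫ x, φ (r • x) ∂(uniformSphere E) with hI
    have hlim : ∫ x, φ x ∂(ENNReal.ofReal (shellMass n a) •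
        (uniformSphere E).map (fun x => r • x)) = shellMass n a * I := by
      rw [integral_smul_measure, integral_map (by fun_prop) hφ.aestronglyMeasurable,
        ENNReal.toReal_ofReal (shellMass_pos hn1 ha).le, smul_eq_mul]
    rw [hlim]
    have hvol := tendsto_volume_shell (E := E) ha
    have hfin : ∀ h, volume (shell E a h) ≠ ⊤ := fun h => by
      refine ((measure_mono fun x hx => ?_).trans_lt
        (measure_ball_lt_top (x := (0 : E)) (r := √(2 * (a + h))))).ne
      rw [mem_ball_zero_iff, Real.lt_sqrt (norm_nonneg x)]
      linarith [hx.2]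
    have hdiff : Tendsto (fun h => h⁻¹ * ∫ x in shell E a h, (φ x - φ (r • ‖x‖⁻¹ • x))) (𝓝[>] 0)
        (𝓝 0) := by
      rw [Metric.tendsto_nhds]
      intro ε hε
      set Z := shellMass n a
      have hZ : 0 < Z := shellMass_pos hn1 ha
      -- The volume quotient is eventually below `Z + 1`, so this tolerance yields a total error of
      -- at most `ε / 2`.
      obtain ⟨δ, hδ, hδφ⟩ := Metric.uniformContinuous_iff.1
        (hc.uniformContinuous_of_continuous hφ) (ε / (2 * (Z + 1))) (by positivity)
      have hsq : ∀ᶠ h in 𝓝[>] (0 : ℝ), √(2 * (a + h)) < r + δ := by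
        have : Tendsto (fun h : ℝ => √(2 * (a + h))) (𝓝[>] 0) (𝓝 r) := by
          have : Continuous fun h : ℝ => √(2 * (a + h)) := by fun_prop
          refine ((this.tendsto 0).mono_left nhdsWithin_le_nhds).trans ?_
          rw [add_zero]
        exact this.eventually_lt_const (by linarith)
      filter_upwards [hsq, hvol.eventually_lt_const (by linarith : Z < Z + 1),
        self_mem_nhdsWithin] with h h1 h2 h3
      have h3 : 0 < h := h3
      have hb : ∀ x ∈ shell E a h, ‖φ x - φ (r • ‖x‖⁻¹ • x)‖ ≤ ε / (2 * (Z + 1)) := by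
        intro x hx
        have hr1 : r ≤ ‖x‖ := Real.sqrt_le_iff.2 ⟨norm_nonneg _, by linarith [hx.1]⟩
        have hr2 : ‖x‖ < r + δ :=
          ((Real.lt_sqrt (norm_nonneg x)).2 (by linarith [hx.2])).trans h1
        have hx0 : 0 < ‖x‖ := (Real.sqrt_pos.2 (by linarith)).trans_le hr1
        rw [← dist_eq_norm]
        refine (hδφ ?_).le
        have : x - r • ‖x‖⁻¹ • x = ((‖x‖ - r) * ‖x‖⁻¹) • x := by
          rw [sub_mul, mul_inv_cancel₀ hx0.ne', sub_smul, one_smul, mul_smul]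
        rw [dist_eq_norm, this, norm_smul, norm_mul, norm_inv, norm_norm, mul_assoc,
          inv_mul_cancel₀ hx0.ne', mul_one, Real.norm_eq_abs, abs_of_nonneg (by linarith)]
        linarith
      have h4 := norm_setIntegral_le_of_norm_le_const (hfin h).lt_top hb
      rw [dist_zero_right, norm_mul, norm_inv, Real.norm_eq_abs h, abs_of_pos h3]
      calc _ ≤ h⁻¹ * (ε / (2 * (Z + 1)) * volume.real (shell E a h)) := by gcongr
        _ = ε / (2 * (Z + 1)) * (h⁻¹ * volume.real (shell E a h)) := by ring
        _ ≤ ε / (2 * (Z + 1)) * (Z + 1) := by gcongr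
        _ = ε / 2 := by field_simp
        _ < ε := by linarith
    have := hdiff.add (hvol.mul_const I)
    rw [zero_add] at this
    refine this.congr' (Eventually.of_forall fun h => ?_)
    have hψ : Continuous fun x => φ (r • x) := by fun_prop
    have e1 := setIntegral_shell_comp_normalize (E := E) a h hψ
    have i1 : IntegrableOn φ (shell E a h) :=
      (hφ.integrable_of_hasCompactSupport hc).integrableOn
    have i2 : IntegrableOn (fun x : E => φ (r • ‖x‖⁻¹ • x)) (shell E a h) := by
      obtain ⟨M, hM⟩ := hc.exists_bound_of_continuous hφ
      have hm : Measurable fun x : E => φ (r • ‖x‖⁻¹ • x) := hφ.measurable.comp (by fun_prop)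
      exact Measure.integrableOn_of_bounded (M := M) (hfin h) hm.aestronglyMeasurable
        (ae_of_all _ fun x => hM _)
    simp only []
    rw [integral_sub i1 i2, e1, ← hI]
    simp only [shell]
    ring

/-- Integrals against compactly supported continuous functions determine a locally finite measure
here. Hence the choice made in `delta` is immaterial. -/
theorem IsDelta.unique {f : E → ℝ} {a : ℝ} {μ ν : Measure E} (hμ : IsDelta f a μ)
    (hν : IsDelta f a ν) : μ = ν := by
  have := hμ.locallyFinite
  have := hν.locallyFinite
  exact Measure.ext_of_integral_eq_on_compactlySupported fun φ =>
    tendsto_nhds_unique (hμ.tendsto φ φ.continuous φ.hasCompactSupport)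
      (hν.tendsto φ φ.continuous φ.hasCompactSupport)

lemma delta_eq {f : E → ℝ} {a : ℝ} {μ : Measure E} (hμ : IsDelta f a μ) : delta f a = μ := by
  have h : ∃ μ : Measure E, IsDelta f a μ := ⟨μ, hμ⟩
  rw [delta, dif_pos h]
  exact h.choose_spec.unique hμ

theorem microcanonical_eq [Nontrivial E] {β e : ℝ} {n : ℕ} (h : 0 < n / (2 * β) + e) :
    microcanonical E β n e = ENNReal.ofReal (shellMass (Module.finrank ℝ E) (n / (2 * β) + e)) •
      (uniformSphere E).map (fun x => √(2 * (n / (2 * β) + e)) • x) :=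
  delta_eq (isDelta_uniformSphere h)

end Delta

/-! ### Asymptotics of the total mass -/

/-- The logarithm of the total mass of the microcanonical measure at energy shift `0`. -/
def logMass (β : ℝ) (n : ℕ) : ℝ := Real.log (shellMass n (n / (2 * β)))

/-- `log Γ(n/2 + 1)` minus the leading terms of its Stirling expansion. -/
def gammaRemainder (n : ℕ) : ℝ :=
  Real.log (Real.Gamma (n / 2 + 1)) -
    ((n / 2 : ℝ) * Real.log (n / 2) - n / 2 + Real.log n / 2)

/-- The ball volumes cancel in the difference, leaving `(n/2 - 1) log(1 + 2βe/n)`. -/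
theorem tendsto_log_shellMass_sub {β : ℝ} (hβ : 0 < β) (e : ℝ) :
    Tendsto (fun n : ℕ => Real.log (shellMass n (n / (2 * β) + e)) - logMass β n) atTop
      (𝓝 (β * e)) := by
  have h1 : Tendsto (fun n : ℕ => (n : ℝ) * Real.log (1 + (2 * β * e) / n)) atTop
      (𝓝 (2 * β * e)) :=
    (Real.tendsto_mul_log_one_add_div_atTop (2 * β * e)).comp tendsto_natCast_atTop_atTop
  have h2 : Tendsto (fun n : ℕ => (1 / 2 - 1 / (n : ℝ)) * (n * Real.log (1 + (2 * β * e) / n)))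
      atTop (𝓝 ((1 / 2 - 0) * (2 * β * e))) :=
    (tendsto_const_nhds.sub tendsto_one_div_atTop_nhds_zero_nat).mul h1
  rw [show (1 / 2 - 0) * (2 * β * e) = β * e by ring] at h2
  refine h2.congr' ?_
  have hpos : ∀ᶠ n : ℕ in atTop, 0 < (n : ℝ) / (2 * β) + e := by
    have : Tendsto (fun n : ℕ => (n : ℝ) / (2 * β) + e) atTop atTop :=
      tendsto_atTop_add_const_right _ _
        (tendsto_natCast_atTop_atTop.atTop_div_const (by positivity))
    exact this.eventually_gt_atTop 0
  filter_upwards [hpos, eventually_ge_atTop 1] with n hn hn1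
  have hn0 : (0 : ℝ) < n := by exact_mod_cast hn1
  have hω := unitBallVolume_pos n
  have e1 : 2 * ((n : ℝ) / (2 * β) + e) = (2 * (n / (2 * β))) * (1 + (2 * β * e) / n) := by
    field_simp
  have e2 : 0 < 1 + (2 * β * e) / n := by
    have : 0 < 2 * ((n : ℝ) / (2 * β) + e) := by positivity
    rw [e1] at this
    exact pos_of_mul_pos_right this (by positivity)
  have e3 : shellMass n (n / (2 * β) + e) =
      shellMass n (n / (2 * β)) * (1 + (2 * β * e) / n) ^ (n / 2 - 1 : ℝ) := by
    rw [shellMass, shellMass, e1, Real.mul_rpow (by positivity) e2.le]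
    ring
  have e4 : 0 < shellMass n (n / (2 * β)) := shellMass_pos hn1 (by positivity)
  rw [logMass, e3, Real.log_mul e4.ne' (by positivity), add_sub_cancel_left, Real.log_rpow e2]
  field_simp

/-- The factor `n · n^(n/2-1)` cancels the `n^(n/2)` in Stirling's formula for `Γ(n/2+1)`; what
remains is `(2π exp(1)/β)^(n/2) n^(-1/2)` up to a bounded factor. -/
lemma logMass_eq {β : ℝ} (hβ : 0 < β) {n : ℕ} (hn : 1 ≤ n) :
    logMass β n = (n : ℝ) * (Real.log (2 * Real.pi * Real.exp 1 / β) / 2) - Real.log n / 2 +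
      (Real.log β - gammaRemainder n) := by
  have hn0 : (0 : ℝ) < n := by exact_mod_cast hn
  have hω := unitBallVolume_pos n
  have hΓ : 0 < Real.Gamma (n / 2 + 1) := Real.Gamma_pos_of_pos (by positivity)
  rw [logMass, shellMass, Real.log_mul (by positivity) (by positivity),
    Real.log_mul (by positivity) hω.ne', Real.log_rpow (by positivity), unitBallVolume,
    Real.log_div (by positivity) hΓ.ne', Real.log_pow, Real.log_sqrt Real.pi_pos.le,
    gammaRemainder, show (2 * ((n : ℝ) / (2 * β))) = n / β by field_simp,
    Real.log_div hn0.ne' hβ.ne', Real.log_div (by positivity) hβ.ne',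
    Real.log_mul (by positivity) (by positivity), Real.log_mul (by positivity) (by positivity),
    Real.log_exp, Real.log_div hn0.ne' (by norm_num)]
  ring

lemma gammaRemainder_even {m : ℕ} (hm : 1 ≤ m) :
    gammaRemainder (2 * m) = Real.log (Stirling.stirlingSeq m) := by
  have hm0 : (0 : ℝ) < m := by exact_mod_cast hm
  rw [Stirling.log_stirlingSeq_formula, gammaRemainder, Nat.cast_mul, Nat.cast_two,
    mul_div_cancel_left₀ _ two_ne_zero, Real.Gamma_nat_eq_factorial,
    Real.log_div hm0.ne' (Real.exp_ne_zero _), Real.log_exp]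
  ring

/-- Legendre's duplication formula expresses `Γ(m + 3/2)` through `(2m+1)!` and `m!`, reducing
half-integers to Stirling for factorials. -/
lemma gammaRemainder_odd {m : ℕ} (hm : 1 ≤ m) :
    gammaRemainder (2 * m + 1) = Real.log (Stirling.stirlingSeq (2 * m + 1)) -
      Real.log (Stirling.stirlingSeq m) + Real.log Real.pi / 2 +
      (m + 1 / 2) * Real.log (1 + 1 / (2 * m)) - 1 / 2 := by
  have hm0 : (0 : ℝ) < m := by exact_mod_cast hm
  have h1 := Real.Gamma_mul_Gamma_add_half (m + 1 : ℝ)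
  rw [Real.Gamma_nat_eq_factorial, show (2 * ((m : ℝ) + 1)) = ((2 * m + 1 : ℕ) : ℝ) + 1 by
    push_cast; ring, Real.Gamma_nat_eq_factorial] at h1
  have hΓ : 0 < Real.Gamma (m + 1 + 1 / 2) := Real.Gamma_pos_of_pos (by positivity)
  have h2 := congrArg Real.log h1
  rw [Real.log_mul (by positivity) hΓ.ne', Real.log_mul (by positivity) (by positivity),
    Real.log_mul (by positivity) (by positivity), Real.log_rpow two_pos,
    Real.log_sqrt Real.pi_pos.le] at h2
  have h3 : Real.log (1 + 1 / (2 * m)) = Real.log (2 * m + 1) - Real.log 2 - Real.log m := by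
    rw [show (1 + 1 / (2 * m) : ℝ) = (2 * m + 1) / (2 * m) by field_simp,
      Real.log_div (by positivity) (by positivity), Real.log_mul two_ne_zero hm0.ne']
    ring
  rw [Stirling.log_stirlingSeq_formula, Stirling.log_stirlingSeq_formula, gammaRemainder, h3]
  push_cast at h2 ⊢
  rw [show ((2 * m + 1) / 2 + 1 : ℝ) = m + 1 + 1 / 2 by ring, eq_sub_of_add_eq' h2,
    Real.log_div (by positivity) (Real.exp_ne_zero _),
    Real.log_div hm0.ne' (Real.exp_ne_zero _), Real.log_exp,
    Real.log_div (by positivity) two_ne_zero, Real.log_mul two_ne_zero (by positivity),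
    Real.log_mul two_ne_zero hm0.ne']
  ring

/-- Boundedness is enough, since the competing terms are `n` and `log n`. It follows from the
convergence of `stirlingSeq`. -/
lemma gammaRemainder_bounded : ∃ M, ∀ᶠ n : ℕ in atTop, |gammaRemainder n| ≤ M := by
  have hs : Tendsto (fun m => Real.log (Stirling.stirlingSeq m)) atTop
      (𝓝 (Real.log √Real.pi)) :=
    Stirling.tendsto_stirlingSeq_sqrt_pi.log (Real.sqrt_pos.2 Real.pi_pos).ne'
  obtain ⟨K, hK⟩ := (Metric.isBounded_range_of_tendsto _ hs).exists_norm_le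
  have hK' : ∀ m, |Real.log (Stirling.stirlingSeq m)| ≤ K := fun m => hK _ ⟨m, rfl⟩
  have hπ : 0 ≤ Real.log Real.pi := Real.log_nonneg (by linarith [Real.pi_gt_three])
  -- Starting at `n = 2` makes `m ≥ 1` for both parities.
  refine ⟨K + K + Real.log Real.pi + 2, eventually_atTop.2 ⟨2, fun n hn => ?_⟩⟩
  have hK0 : 0 ≤ K := (abs_nonneg _).trans (hK' 0)
  obtain ⟨m, rfl | rfl⟩ := Nat.even_or_odd' n
  · rw [gammaRemainder_even (by omega)]
    linarith [hK' m]
  · have hm : 1 ≤ m := by omega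
    have hm1 : (1 : ℝ) ≤ m := by exact_mod_cast hm
    have h1 : 0 ≤ Real.log (1 + 1 / (2 * m)) := Real.log_nonneg (by simp)
    have h2 : Real.log (1 + 1 / (2 * m)) ≤ 1 / (2 * m) := by
      linarith [Real.log_le_sub_one_of_pos (show (0 : ℝ) < 1 + 1 / (2 * m) by positivity)]
    have h3 : ((m : ℝ) + 1 / 2) * Real.log (1 + 1 / (2 * m)) ≤ 1 := by
      calc _ ≤ ((m : ℝ) + 1 / 2) * (1 / (2 * m)) := by gcongr
        _ ≤ 1 := by
          rw [mul_one_div, div_le_one (by positivity)]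
          linarith
    have h4 : 0 ≤ ((m : ℝ) + 1 / 2) * Real.log (1 + 1 / (2 * m)) := by positivity
    rw [gammaRemainder_odd hm, abs_le]
    have h5 := abs_le.1 (hK' m)
    have h6 := abs_le.1 (hK' (2 * m + 1))
    constructor <;> linarith [h5.1, h5.2, h6.1, h6.2]

theorem tendsto_logMass_atTop {β : ℝ} (hβ : 0 < β) (h : β < 2 * Real.pi * Real.exp 1) :
    Tendsto (logMass β) atTop atTop := by
  obtain ⟨M, hM⟩ := gammaRemainder_bounded
  set c := Real.log (2 * Real.pi * Real.exp 1 / β) / 2 with hcdef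
  have hc : 0 < c := div_pos (Real.log_pos ((one_lt_div hβ).2 h)) two_pos
  have h1 : Tendsto (fun n : ℕ => (n : ℝ) * (c - Real.log n / n / 2) + (Real.log β - M))
      atTop atTop := by
    refine tendsto_atTop_add_const_right _ _ (Tendsto.atTop_mul_pos hc
      tendsto_natCast_atTop_atTop ?_)
    have : Tendsto (fun x : ℝ => Real.log x / x) atTop (𝓝 0) :=
      Real.isLittleO_log_id_atTop.tendsto_div_nhds_zero
    simpa using ((this.comp tendsto_natCast_atTop_atTop).div_const 2).const_sub c
  refine tendsto_atTop_mono' _ ?_ h1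
  filter_upwards [hM, eventually_ge_atTop 1] with n hn hn1
  have hn0 : (n : ℝ) ≠ 0 := by positivity
  rw [logMass_eq hβ hn1, ← hcdef]
  have : (n : ℝ) * (c - Real.log n / n / 2) = n * c - Real.log n / 2 := by
    field_simp
  rw [this]
  linarith [(abs_le.1 hn).2]

/-- The linear term is at most zero and is dropped; `-(log n)/2` alone forces divergence, which
covers `β = 2π exp(1)`. -/
theorem tendsto_logMass_atBot {β : ℝ} (h : 2 * Real.pi * Real.exp 1 ≤ β) :
    Tendsto (logMass β) atTop atBot := by
  obtain ⟨M, hM⟩ := gammaRemainder_bounded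
  have hβ : 0 < β := lt_of_lt_of_le (by positivity) h
  set c := Real.log (2 * Real.pi * Real.exp 1 / β) / 2 with hcdef
  have hc : c ≤ 0 := div_nonpos_of_nonpos_of_nonneg
    (Real.log_nonpos (by positivity) ((div_le_one hβ).2 h)) two_pos.le
  have h1 : Tendsto (fun n : ℕ => -(Real.log n / 2) + (Real.log β + M)) atTop atBot :=
    tendsto_atBot_add_const_right _ _ (tendsto_neg_atTop_atBot.comp
      ((Real.tendsto_log_atTop.comp tendsto_natCast_atTop_atTop).atTop_div_const two_pos))
  refine tendsto_atBot_mono' _ ?_ h1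
  filter_upwards [hM, eventually_ge_atTop 1] with n hn hn1
  have : (n : ℝ) * c ≤ 0 := mul_nonpos_of_nonneg_of_nonpos (by positivity) hc
  rw [logMass_eq hβ hn1, ← hcdef]
  linarith [(abs_le.1 hn).1]

/-! ### Recognizing real Gaussian laws -/

/-- A random variable with the moment generating function of a Gaussian is Gaussian. -/
lemma map_eq_gaussianReal_of_mgf {Ω : Type*} {mΩ : MeasurableSpace Ω} {μ : Measure Ω}
    [IsProbabilityMeasure μ] {Y : Ω → ℝ} (hY : AEMeasurable Y μ) {m : ℝ} {v : NNReal}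
    (h : ∀ t, mgf Y μ t = Real.exp (m * t + v * t ^ 2 / 2)) : μ.map Y = gaussianReal m v := by
  have h1 : mgf id (gaussianReal m v) = mgf Y μ := by
    rw [mgf_id_gaussianReal]; ext t; rw [h]
  have h2 := eqOn_complexMGF_of_mgf h1
  -- All exponential moments of a Gaussian are finite, so the complex functions agree on all of `ℂ`.
  rw [integrableExpSet_id_gaussianReal] at h2
  have h3 : complexMGF Y μ = complexMGF id (gaussianReal m v) := by
    ext z
    exact (h2 (by simp)).symm
  rw [Measure.ext_of_complexMGF_eq hY aemeasurable_id h3, Measure.map_id]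

/-- An almost sure limit of centered Gaussian variables is a centered Gaussian variable. -/
lemma map_eq_gaussianReal_of_tendsto {Ω : Type*} {mΩ : MeasurableSpace Ω} {μ : Measure Ω}
    [IsProbabilityMeasure μ] {f : ℕ → Ω → ℝ} {g : Ω → ℝ} {c : ℕ → ℝ} {d : ℝ}
    (hf : ∀ k, AEMeasurable (f k) μ)
    (hlaw : ∀ k, μ.map (f k) = gaussianReal 0 (c k).toNNReal) (hc : Tendsto c atTop (𝓝 d))
    (hlim : ∀ᵐ ω ∂μ, Tendsto (fun k => f k ω) atTop (𝓝 (g ω))) :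
    μ.map g = gaussianReal 0 d.toNNReal := by
  have hg : AEMeasurable g μ := aemeasurable_of_tendsto_metrizable_ae atTop hf hlim
  have : IsProbabilityMeasure (μ.map g) := Measure.isProbabilityMeasure_map hg
  refine Measure.ext_of_charFun ?_
  ext t
  have h1 : Tendsto (fun k => charFun (μ.map (f k)) t) atTop (𝓝 (charFun (μ.map g) t)) := by
    simp_rw [charFun_apply_real]
    rw [integral_map hg (by fun_prop)]
    simp_rw [fun k => integral_map (μ := μ) (hf k)
      (f := fun x : ℝ => Complex.exp (t * x * Complex.I)) (by fun_prop)]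
    refine tendsto_integral_of_dominated_convergence (fun _ => 1) (fun k => ?_)
      (integrable_const _) (fun k => ae_of_all _ fun ω => ?_) ?_
    · exact (by fun_prop : Measurable fun x : ℝ => Complex.exp (t * x * Complex.I)).comp_aemeasurable
        (hf k) |>.aestronglyMeasurable
    · rw [← Complex.ofReal_mul, Complex.norm_exp_ofReal_mul_I]
    · filter_upwards [hlim] with ω hω
      have : Continuous fun x : ℝ => Complex.exp (t * x * Complex.I) := by fun_prop
      exact (this.tendsto _).comp hω
  have h2 : Tendsto (fun k => charFun (μ.map (f k)) t) atTop
      (𝓝 (charFun (gaussianReal 0 d.toNNReal) t)) := by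
    simp_rw [hlaw, charFun_gaussianReal]
    have : Continuous fun x : ℝ =>
        Complex.exp (t * (0 : ℝ) * Complex.I - (x.toNNReal : ℝ) * t ^ 2 / 2) := by
      have : Continuous fun x : ℝ => ((x.toNNReal : ℝ) : ℂ) :=
        Complex.continuous_ofReal.comp (NNReal.continuous_coe.comp continuous_real_toNNReal)
      fun_prop
    exact (this.tendsto d).comp hc
  exact tendsto_nhds_unique h1 h2

lemma eLpNorm_two_of_map_eq_gaussianReal {Ω : Type*} {mΩ : MeasurableSpace Ω} {μ : Measure Ω} {Y : Ω → ℝ}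
    (hY : AEMeasurable Y μ) {v : NNReal} (h : μ.map Y = gaussianReal 0 v) :
    eLpNorm Y 2 μ = ENNReal.ofReal √(v : ℝ) := by
  have h1 : eLpNorm Y 2 μ = eLpNorm id 2 (gaussianReal 0 v) := by
    rw [← h, eLpNorm_map_measure (by fun_prop) hY, Function.id_comp]
  have h2 : MemLp id 2 (gaussianReal 0 v) := memLp_id_gaussianReal' 2 (by simp)
  have h3 := variance_id_gaussianReal (μ := 0) (v := v)
  rw [variance_of_integral_eq_zero aemeasurable_id (by simp)] at h3
  rw [h1, h2.eLpNorm_eq_integral_rpow_norm (by simp) (by simp)]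
  congr 1
  rw [← h3, Real.sqrt_eq_rpow]
  simp

/-! ### Gaussian measures on a Hilbert space: Cameron–Martin and the zero-one law -/

section Hilbert

variable {X : Type*} [NormedAddCommGroup X] [InnerProductSpace ℝ X] [MeasurableSpace X]

/-- The marginal along the zero vector already carries the total mass. -/
lemma IsCenteredGaussian.isProbabilityMeasure {R : X →L[ℝ] X} {γ : Measure X}
    (h : IsCenteredGaussian R γ) : IsProbabilityMeasure γ := by
  constructor
  have h0 := congrArg (fun μ => μ Set.univ) (h 0)
  simpa [Measure.map_apply measurable_const] using h0

/-- A finite Borel measure on a Hilbert space is determined by its one-dimensional marginals. -/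
lemma ext_of_map_inner [BorelSpace X] [SecondCountableTopology X] [CompleteSpace X]
    {μ ν : Measure X} [IsFiniteMeasure μ] [IsFiniteMeasure ν]
    (h : ∀ v : X, μ.map (fun x => inner ℝ v x) = ν.map (fun x => inner ℝ v x)) : μ = ν := by
  refine Measure.ext_of_charFun ?_
  ext v
  have key : ∀ ρ : Measure X, charFun ρ v =
      ∫ s, Complex.exp (s * Complex.I) ∂(ρ.map (fun x => inner ℝ v x)) := fun ρ => by
    rw [integral_map (by fun_prop) (by fun_prop), charFun_apply]
    simp_rw [real_inner_comm]
  rw [key, key, h]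

variable [BorelSpace X] [SecondCountableTopology X] [CompleteSpace X] {R : X →L[ℝ] X}
  {γ : Measure X}

omit [CompleteSpace X] in
lemma IsCenteredGaussian.integrable_exp (h : IsCenteredGaussian R γ) (u : X) :
    Integrable (fun x => Real.exp (inner ℝ u x)) γ := by
  have h1 : Integrable (fun s => Real.exp (1 * s)) (γ.map (fun x => inner ℝ u x)) := by
    rw [h u]; exact integrable_exp_mul_gaussianReal 1
  simpa [Function.comp_def] using h1.comp_measurable (f := fun x => inner ℝ u x) (by fun_prop)

omit [BorelSpace X] [SecondCountableTopology X] [CompleteSpace X] in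
lemma IsCenteredGaussian.integral_exp (h : IsCenteredGaussian R γ)
    (hR : ∀ x, 0 ≤ inner ℝ (R x) x) (u : X) :
    ∫ x, Real.exp (inner ℝ u x) ∂γ = Real.exp (inner ℝ (R u) u / 2) := by
  have := mgf_gaussianReal (h u) 1
  simpa [mgf, hR u] using this

/-- The Cameron–Martin formula for shifts in the range of the covariance operator. -/
theorem IsCenteredGaussian.map_add (h : IsCenteredGaussian R γ)
    (hR : ∀ x, 0 ≤ inner ℝ (R x) x) (hsymm : ∀ x y, inner ℝ (R x) y = inner ℝ x (R y)) (u : X) :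
    γ.map (fun x => x + R u) = γ.withDensity fun x =>
      ENNReal.ofReal (Real.exp (inner ℝ u x - inner ℝ (R u) u / 2)) := by
  have := h.isProbabilityMeasure
  set q := inner ℝ (R u) u
  set ν := γ.withDensity fun x => ENNReal.ofReal (Real.exp (inner ℝ u x - q / 2))
  have : IsProbabilityMeasure (γ.map fun x => x + R u) :=
    Measure.isProbabilityMeasure_map (by fun_prop)
  have hint : ∀ f : X → ℝ, ∫ x, f x ∂ν = ∫ x, Real.exp (inner ℝ u x - q / 2) * f x ∂γ := by
    intro f
    rw [integral_withDensity_eq_integral_toReal_smul (by fun_prop) (by simp)]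
    refine integral_congr_ae (ae_of_all _ fun x => ?_)
    simp only [smul_eq_mul, ENNReal.toReal_ofReal (Real.exp_pos _).le]
  have hν : IsProbabilityMeasure ν := by
    constructor
    have hi : Integrable (fun x => Real.exp (inner ℝ u x - q / 2)) γ := by
      simp_rw [Real.exp_sub]; exact (h.integrable_exp u).div_const _
    rw [withDensity_apply _ .univ, setLIntegral_univ, ← ofReal_integral_eq_lintegral_ofReal hi
      (ae_of_all _ fun _ => (Real.exp_pos _).le)]
    simp_rw [Real.exp_sub]
    rw [integral_div, h.integral_exp hR, div_self (Real.exp_ne_zero _), ENNReal.ofReal_one]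
  -- Along each `v` both measures have the Gaussian marginal with mean `⟪R v, u⟫` and variance `⟪R
  -- v, v⟫`.
  refine ext_of_map_inner fun v => ?_
  have e1 : (γ.map fun x => x + R u).map (fun x => inner ℝ v x) =
      gaussianReal (inner ℝ (R v) u) (inner ℝ (R v) v).toNNReal := by
    refine map_eq_gaussianReal_of_mgf (by fun_prop) fun t => ?_
    rw [mgf, integral_map (by fun_prop) (by fun_prop)]
    have : ∀ x : X, Real.exp (t * inner ℝ v (x + R u)) =
        Real.exp (inner ℝ (t • v) x) * Real.exp (t * inner ℝ (R v) u) := fun x => by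
      rw [← Real.exp_add, inner_add_right, ← hsymm v u, real_inner_smul_left]; ring_nf
    simp_rw [this]
    rw [integral_mul_const, h.integral_exp hR, ← Real.exp_add, map_smul, real_inner_smul_left,
      real_inner_smul_right, Real.coe_toNNReal _ (hR v)]
    ring_nf
  have e2 : ν.map (fun x => inner ℝ v x) =
      gaussianReal (inner ℝ (R v) u) (inner ℝ (R v) v).toNNReal := by
    refine map_eq_gaussianReal_of_mgf (by fun_prop) fun t => ?_
    rw [mgf, hint]
    have : ∀ x : X, Real.exp (inner ℝ u x - q / 2) * Real.exp (t * inner ℝ v x) =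
        Real.exp (inner ℝ (t • v + u) x) * Real.exp (-(q / 2)) := fun x => by
      rw [← Real.exp_add, ← Real.exp_add, inner_add_left, real_inner_smul_left]; ring_nf
    simp_rw [this]
    have hvu : inner ℝ (R u) v = inner ℝ (R v) u := by rw [hsymm, real_inner_comm]
    rw [integral_mul_const, h.integral_exp hR, ← Real.exp_add, _root_.map_add, map_smul,
      inner_add_left, inner_add_right, inner_add_right, real_inner_smul_left, real_inner_smul_left,
      real_inner_smul_right, real_inner_smul_right, Real.coe_toNNReal _ (hR v), hvu]
    simp only [q]
    ring_nf
  rw [e1, e2]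

/-- A set invariant under all shifts in the range of the covariance operator has measure `0` or
`1`. -/
theorem IsCenteredGaussian.measure_eq_zero_or_one (h : IsCenteredGaussian R γ)
    (hR : ∀ x, 0 ≤ inner ℝ (R x) x) (hsymm : ∀ x y, inner ℝ (R x) y = inner ℝ x (R y))
    {A : Set X} (hA : NullMeasurableSet A γ) (hinv : ∀ u x, x + R u ∈ A ↔ x ∈ A) :
    γ A = 0 ∨ γ A = 1 := by
  have := h.isProbabilityMeasure
  refine or_iff_not_imp_left.2 fun h0 => ?_
  have hexp : ∀ u, ∫ x in A, Real.exp (inner ℝ u x) ∂γ =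
      γ.real A * Real.exp (inner ℝ (R u) u / 2) := by
    intro u
    have hcm := h.map_add hR hsymm u
    -- `A` is only null measurable for `γ`; absolute continuity makes it so for the shifted measure.
    have hac : γ.map (fun x => x + R u) ≪ γ := by
      rw [hcm]; exact withDensity_absolutelyContinuous _ _
    have h1 : γ.map (fun x => x + R u) A = γ A := by
      rw [Measure.map_apply₀ (by fun_prop) (hA.mono_ac hac)]
      congr 1
      ext x
      exact hinv u x
    rw [hcm, withDensity_apply₀ _ hA, ← ofReal_integral_eq_lintegral_ofReal _
      (ae_of_all _ fun _ => (Real.exp_pos _).le)] at h1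
    · have h2 := congrArg ENNReal.toReal h1
      rw [ENNReal.toReal_ofReal (integral_nonneg fun _ => (Real.exp_pos _).le)] at h2
      simp_rw [Real.exp_sub] at h2
      rw [integral_div, div_eq_iff (Real.exp_ne_zero _)] at h2
      exact h2
    · simp_rw [Real.exp_sub]
      exact ((h.integrable_exp u).div_const _).integrableOn
  have hprob : IsProbabilityMeasure ((γ A)⁻¹ • γ.restrict A) := ⟨by
    rw [Measure.smul_apply, Measure.restrict_apply_univ, smul_eq_mul,
      ENNReal.inv_mul_cancel h0 (measure_ne_top _ _)]⟩
  -- Invariance and Cameron–Martin show that conditioning on `A` leaves every exponential moment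
  -- unchanged, so `γ` conditioned on `A` is `γ` itself.
  have heq : (γ A)⁻¹ • γ.restrict A = γ := by
    refine ext_of_map_inner fun v => ?_
    rw [h v]
    refine map_eq_gaussianReal_of_mgf (by fun_prop) fun t => ?_
    have : ∀ x : X, t * inner ℝ v x = inner ℝ (t • v) x := fun x => by rw [real_inner_smul_left]
    have hA0 : γ.real A ≠ 0 := by simpa [measureReal_def, ENNReal.toReal_eq_zero_iff] using h0
    rw [mgf, integral_smul_measure]
    simp_rw [this]
    rw [hexp, smul_eq_mul, ENNReal.toReal_inv, ← measureReal_def, inv_mul_cancel_left₀ hA0, map_smul,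
      real_inner_smul_left, real_inner_smul_right, Real.coe_toNNReal _ (hR v)]
    ring_nf
  have hc : γ Aᶜ = 0 := by
    rw [← heq, Measure.smul_apply, Measure.restrict_apply₀' hA, Set.compl_inter_self]
    simp
  rwa [prob_compl_eq_zero_iff₀ hA] at hc

end Hilbert

/-! ### Measurable linear extensions: almost sure uniqueness and existence -/

section Extension

variable {H X : Type*} [NormedAddCommGroup H] [InnerProductSpace ℝ H] [CompleteSpace H]
  [NormedAddCommGroup X] [InnerProductSpace ℝ X] [CompleteSpace X]
  {ι : H →L[ℝ] X} {β : ℝ}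

lemma inner_canonicalCov (x y : X) :
    inner ℝ (canonicalCov ι β x) y = β⁻¹ * inner ℝ (ι.adjoint x) (ι.adjoint y) := by
  rw [canonicalCov, _root_.smul_apply, real_inner_smul_left,
    ContinuousLinearMap.comp_apply, ← ContinuousLinearMap.adjoint_inner_right]

lemma inner_canonicalCov_self (x : X) :
    inner ℝ (canonicalCov ι β x) x = β⁻¹ * ‖ι.adjoint x‖ ^ 2 := by
  rw [inner_canonicalCov, real_inner_self_eq_norm_sq]

lemma inner_canonicalCov_self_nonneg (hβ : 0 < β) (x : X) :
    0 ≤ inner ℝ (canonicalCov ι β x) x := by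
  rw [inner_canonicalCov_self]; positivity

lemma inner_canonicalCov_comm (x y : X) :
    inner ℝ (canonicalCov ι β x) y = inner ℝ x (canonicalCov ι β y) := by
  rw [real_inner_comm (canonicalCov ι β y), inner_canonicalCov, inner_canonicalCov,
    real_inner_comm]

variable [MeasurableSpace X] [BorelSpace X] [SecondCountableTopology X] {γ : Measure X}

lemma IsCenteredGaussian.map_neg {R : X →L[ℝ] X} (h : IsCenteredGaussian R γ) :
    γ.map (fun x => -x) = γ := by
  have := h.isProbabilityMeasure
  refine ext_of_map_inner fun v => ?_
  rw [Measure.map_map (by fun_prop) (by fun_prop), h v]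
  have h1 := h (-v)
  simpa [Function.comp_def] using h1

/-- A measurable linear functional that vanishes on `H` is zero almost surely. -/
theorem ae_eq_zero_of_linear (hγ : IsCenteredGaussian (canonicalCov ι β) γ) (hβ : 0 < β)
    {D : X → ℝ} (hD : NullMeasurable D γ) {L : Submodule ℝ X} (G : L →ₗ[ℝ] ℝ)
    (hL : γ (L : Set X)ᶜ = 0) (hι : ∀ h, ι h ∈ L) (hG : ∀ x : L, D x = G x)
    (h0 : ∀ h, D (ι h) = 0) : ∀ᵐ x ∂γ, D x = 0 := by
  have hLm : NullMeasurableSet (L : Set X) γ := by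
    simpa using (NullMeasurableSet.of_null hL).compl
  -- The positivity set is invariant under shifts by `R u ∈ ι(H)`, hence has measure `0` or `1`. It
  -- is disjoint from its reflection, which has equal measure, so it is null.
  set A : Set X := L ∩ D ⁻¹' Set.Ioi 0
  have hA : NullMeasurableSet A γ := hLm.inter (hD measurableSet_Ioi)
  have hinv : ∀ u x, x + canonicalCov ι β u ∈ A ↔ x ∈ A := by
    intro u x
    have hu : canonicalCov ι β u = ι (β⁻¹ • ι.adjoint u) := by simp [canonicalCov]
    rw [hu]
    set k := β⁻¹ • ι.adjoint u
    have h1 : x + ι k ∈ L ↔ x ∈ L := L.add_mem_iff_left (hι k)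
    have h2 : x ∈ L → D (x + ι k) = D x := fun hx => by
      have e1 := hG ⟨x + ι k, h1.2 hx⟩
      have e2 := hG ⟨x, hx⟩
      have e3 := hG ⟨ι k, hι k⟩
      have e4 : (⟨x + ι k, h1.2 hx⟩ : L) = ⟨x, hx⟩ + ⟨ι k, hι k⟩ := rfl
      rw [e4, map_add, ← e2, ← e3] at e1
      simpa [h0] using e1
    constructor
    · rintro ⟨a, b⟩
      have ha := h1.1 a
      exact ⟨ha, by simpa [h2 ha] using b⟩
    · rintro ⟨a, b⟩
      exact ⟨h1.2 a, by simpa [h2 a] using b⟩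
  have hDneg : ∀ x ∈ L, D (-x) = -D x := fun x hx => by
    have e1 := hG ⟨x, hx⟩
    have e2 := hG (-⟨x, hx⟩)
    rw [map_neg, ← e1] at e2
    exact e2
  have hneg : γ ((fun x => -x) ⁻¹' A) = γ A := by
    have := Measure.map_apply₀ (f := fun x : X => -x) (μ := γ) (s := A) (by fun_prop)
      (by rwa [hγ.map_neg])
    rw [← this, hγ.map_neg]
  have hdisj : (fun x => -x) ⁻¹' A ⊆ Aᶜ := by
    rintro x ⟨hx1, hx2⟩ ⟨hx3, hx4⟩
    have h5 : 0 < D (-x) := hx2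
    have h6 : 0 < D x := hx4
    linarith [hDneg x hx3]
  have hprob := hγ.isProbabilityMeasure
  have hA0 : γ A = 0 := by
    rcases hγ.measure_eq_zero_or_one (inner_canonicalCov_self_nonneg hβ) inner_canonicalCov_comm
      hA hinv with h | h
    · exact h
    · rw [← hneg]
      exact measure_mono_null hdisj ((prob_compl_eq_zero_iff₀ hA).2 h)
  rw [hA0] at hneg
  rw [ae_iff]
  refine measure_mono_null (fun x hx => ?_) (measure_union_null (measure_union_null hA0 hneg) hL)
  by_cases hxL : x ∈ L
  · refine Or.inl ?_
    rcases lt_or_gt_of_ne (show D x ≠ 0 from hx) with h | h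
    · refine Or.inr ⟨L.neg_mem hxL, ?_⟩
      show 0 < D (-x)
      linarith [hDneg x hxL]
    · exact Or.inl ⟨hxL, h⟩
  · exact Or.inr hxL

/-- Measurable linear extensions with values in a finite-dimensional space are almost surely
unique. -/
theorem IsMeasurableLinearExtension.ae_eq {Y : Type*} [NormedAddCommGroup Y]
    [InnerProductSpace ℝ Y] [FiniteDimensional ℝ Y] [MeasurableSpace Y] [BorelSpace Y]
    (hγ : IsCenteredGaussian (canonicalCov ι β) γ) (hβ : 0 < β) {f : H →L[ℝ] Y} {g g' : X → Y}
    (hg : IsMeasurableLinearExtension ι γ f g) (hg' : IsMeasurableLinearExtension ι γ f g') :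
    g =ᵐ[γ] g' := by
  obtain ⟨L, G, hL, hιL, hG⟩ := hg.exists_linear
  obtain ⟨L', G', hL', hιL', hG'⟩ := hg'.exists_linear
  -- Each coordinate of `g - g'` is linear on `L ⊓ L'` and vanishes on `H`.
  have hall : ∀ j, ∀ᵐ x ∂γ, inner ℝ (stdOrthonormalBasis ℝ Y j) (g x - g' x) = (0 : ℝ) := by
    intro j
    refine ae_eq_zero_of_linear hγ hβ (L := L ⊓ L') (G :=
      ((innerSL ℝ (stdOrthonormalBasis ℝ Y j)).toLinearMap ∘ₗ
        (G ∘ₗ Submodule.inclusion inf_le_left - G' ∘ₗ Submodule.inclusion inf_le_right)))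
      (D := fun x => inner ℝ (stdOrthonormalBasis ℝ Y j) (g x - g' x)) ?_ ?_
      (fun h => ⟨hιL h, hιL' h⟩) ?_ ?_
    · have h1 : AEMeasurable (fun x => g x - g' x) γ :=
        hg.nullMeasurable.aemeasurable.sub hg'.nullMeasurable.aemeasurable
      exact (h1.const_inner).nullMeasurable
    · rw [Submodule.coe_inf, Set.compl_inter]
      exact measure_union_null hL hL'
    · intro x
      have e1 := hG ⟨x, x.2.1⟩
      have e2 := hG' ⟨x, x.2.2⟩
      simp only at e1 e2
      rw [e1, e2]
      rfl
    · intro h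
      simp [hg.extends_map, hg'.extends_map]
  filter_upwards [ae_all_iff.2 hall] with x hx
  rw [← sub_eq_zero]
  exact InnerProductSpace.ext_inner_left_basis (𝕜 := ℝ) (stdOrthonormalBasis ℝ Y).toBasis
    fun j => by simpa using hx j

/-- Every vector of `H` defines a measurable linear functional on `X`: it is an almost sure limit
of continuous functionals. -/
theorem exists_seq_adjoint_tendsto (hγ : IsCenteredGaussian (canonicalCov ι β) γ) (hβ : 0 < β)
    (hι : Function.Injective ι) (w : H) :
    ∃ y : ℕ → X, Tendsto (fun k => ι.adjoint (y k)) atTop (𝓝 w) ∧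
      ∀ᵐ x ∂γ, ∃ l : ℝ, Tendsto (fun k => inner ℝ (y k) x) atTop (𝓝 l) := by
  have hdense : DenseRange ι.adjoint := by
    -- The orthogonal complement of the range of `ι*` is the kernel of `ι`.
    have h1 : (ι.adjoint.range)ᗮ = ⊥ := by
      rw [ContinuousLinearMap.orthogonal_range, ContinuousLinearMap.adjoint_adjoint]
      exact LinearMap.ker_eq_bot.2 hι
    exact Submodule.dense_iff_topologicalClosure_eq_top.2
      (Submodule.topologicalClosure_eq_top_iff.2 h1)
  have hex : ∀ k : ℕ, ∃ y : X, ‖ι.adjoint y - w‖ < (1 / 2) ^ k := fun k => by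
    obtain ⟨y, hy⟩ := hdense.exists_dist_lt w (ε := (1 / 2 : ℝ) ^ k) (by positivity)
    exact ⟨y, by rwa [dist_comm, dist_eq_norm] at hy⟩
  choose y hy using hex
  refine ⟨y, ?_, ?_⟩
  · rw [tendsto_iff_norm_sub_tendsto_zero]
    exact squeeze_zero (fun _ => norm_nonneg _) (fun k => (hy k).le)
      (tendsto_pow_atTop_nhds_zero_of_lt_one (by norm_num) (by norm_num))
  -- The `L²(γ)` norm of `⟪y, ·⟫` is `β^(-1/2) ‖ι* y‖`; the geometric rate makes the Cauchy bounds
  -- summable, giving almost sure convergence without passing to a subsequence.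
  · refine Lp.ae_tendsto_of_cauchy_eLpNorm (p := 2) (fun k => by fun_prop) (by norm_num)
      (B := fun k => ENNReal.ofReal (√β⁻¹ * (2 * (1 / 2) ^ k))) ?_ ?_
    · have hs : Summable fun k : ℕ => √β⁻¹ * (2 * (1 / 2 : ℝ) ^ k) :=
        (summable_geometric_two.mul_left 2).mul_left _
      exact hs.tsum_ofReal_ne_top
    · intro N n m hn hm
      have hlaw := hγ (y n - y m)
      have e1 : (fun x => inner ℝ (y n) x) - (fun x => inner ℝ (y m) x) =
          fun x => inner ℝ (y n - y m) x := by
        ext x; simp [inner_sub_left]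
      rw [e1, eLpNorm_two_of_map_eq_gaussianReal (by fun_prop) hlaw,
        Real.coe_toNNReal _ (inner_canonicalCov_self_nonneg hβ _), inner_canonicalCov_self,
        Real.sqrt_mul (by positivity), Real.sqrt_sq (norm_nonneg _)]
      refine (ENNReal.ofReal_lt_ofReal_iff (by positivity)).2 ?_
      refine mul_lt_mul_of_pos_left ?_ (by positivity)
      have hp : ∀ k, N ≤ k → ((1 : ℝ) / 2) ^ k ≤ (1 / 2) ^ N := fun k hk =>
        pow_le_pow_of_le_one (by norm_num) (by norm_num) hk
      calc ‖ι.adjoint (y n - y m)‖ = ‖(ι.adjoint (y n) - w) - (ι.adjoint (y m) - w)‖ := by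
            rw [map_sub]; congr 1; abel
        _ ≤ ‖ι.adjoint (y n) - w‖ + ‖ι.adjoint (y m) - w‖ := norm_sub_le _ _
        _ < 2 * (1 / 2) ^ N := by linarith [hy n, hy m, hp n hn, hp m hm]

/-- Measurable linear extensions of finite-rank operators exist, and are almost sure limits of
continuous linear operators. -/
theorem exists_isMeasurableLinearExtension (hγ : IsCenteredGaussian (canonicalCov ι β) γ)
    (hβ : 0 < β) (hι : Function.Injective ι) (W : Submodule ℝ H) [FiniteDimensional ℝ W]
    [MeasurableSpace W] [BorelSpace W] :
    ∃ P : X → W, IsMeasurableLinearExtension ι γ W.orthogonalProjectionOnto P ∧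
      ∀ v : X, γ.map (fun x => inner ℝ v (x - ι (P x))) =
        gaussianReal 0 (β⁻¹ * ‖Wᗮ.starProjection (ι.adjoint v)‖ ^ 2).toNNReal := by
  have hprob := hγ.isProbabilityMeasure
  set b := stdOrthonormalBasis ℝ W
  choose y hy hlim using fun j => exists_seq_adjoint_tendsto hγ hβ hι (b j : H)
  -- Where the limit does not exist, `limUnder` takes an arbitrary value; this happens only outside
  -- `L`, a null set.
  set ℓ : ∀ _ : Fin (Module.finrank ℝ W), X → ℝ :=
    fun j x => limUnder atTop (fun k => inner ℝ (y j k) x)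
  have hℓ : ∀ j x l, Tendsto (fun k => inner ℝ (y j k) x) atTop (𝓝 l) → ℓ j x = l :=
    fun j x l h => h.limUnder_eq
  have hℓ' : ∀ j x, (∃ l : ℝ, Tendsto (fun k => inner ℝ (y j k) x) atTop (𝓝 l)) →
      Tendsto (fun k => inner ℝ (y j k) x) atTop (𝓝 (ℓ j x)) := by
    rintro j x ⟨l, hl⟩
    rwa [hℓ j x l hl]
  let L : Submodule ℝ X :=
    { carrier := {x | ∀ j, ∃ l : ℝ, Tendsto (fun k => inner ℝ (y j k) x) atTop (𝓝 l)}
      add_mem' := by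
        intro x x' hx hx' j
        obtain ⟨l, hl⟩ := hx j
        obtain ⟨l', hl'⟩ := hx' j
        exact ⟨l + l', by simpa [inner_add_right] using hl.add hl'⟩
      zero_mem' := fun j => ⟨0, by simp⟩
      smul_mem' := by
        intro c x hx j
        obtain ⟨l, hl⟩ := hx j
        exact ⟨c * l, by simpa [real_inner_smul_right] using hl.const_mul c⟩ }
  have hL : ∀ᵐ x ∂γ, x ∈ L := ae_all_iff.2 hlim
  have hιℓ : ∀ j h, Tendsto (fun k => inner ℝ (y j k) (ι h)) atTop (𝓝 (inner ℝ (b j : H) h)) := by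
    intro j h
    simp_rw [← ContinuousLinearMap.adjoint_inner_left]
    exact (hy j).inner tendsto_const_nhds
  have hadd : ∀ j (x x' : L), ℓ j ((x : X) + x') = ℓ j x + ℓ j x' := fun j x x' =>
    hℓ j _ _ (by simpa [inner_add_right] using (hℓ' j x (x.2 j)).add (hℓ' j x' (x'.2 j)))
  have hsmul : ∀ j (c : ℝ) (x : L), ℓ j (c • (x : X)) = c * ℓ j x := fun j c x =>
    hℓ j _ _ (by simpa [real_inner_smul_right] using (hℓ' j x (x.2 j)).const_mul c)
  have hℓm : ∀ j, AEMeasurable (ℓ j) γ := fun j =>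
    aemeasurable_of_tendsto_metrizable_ae atTop (fun k => by fun_prop)
      (hL.mono fun x hx => hℓ' j x (hx j))
  let P : X → W := fun x => ∑ j, ℓ j x • b j
  have hPm : AEMeasurable P γ := by fun_prop
  refine ⟨P, ⟨hPm.nullMeasurable, ⟨L, ?_, ?_, ?_, ?_⟩, ?_⟩, ?_⟩
  · exact
      { toFun := fun x => P x
        map_add' := fun x x' => by simp [P, hadd, add_smul, Finset.sum_add_distrib]
        map_smul' := fun c x => by simp [P, hsmul, mul_smul, Finset.smul_sum] }
  · exact hL
  · exact fun h j => ⟨_, hιℓ j h⟩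
  · exact fun x => rfl
  · intro h
    have : ∀ j, ℓ j (ι h) = inner ℝ (b j) (W.orthogonalProjectionOnto h) := fun j => by
      rw [hℓ j _ _ (hιℓ j h), Submodule.inner_orthogonalProjectionOnto_eq_of_mem_left]
    simp only [P, this]
    exact b.sum_repr' _
  · intro v
    set c : Fin (Module.finrank ℝ W) → ℝ := fun j => inner ℝ (b j : H) (ι.adjoint v)
    have hvP : ∀ x, inner ℝ v (ι (P x)) = ∑ j, ℓ j x * c j := by
      intro x
      rw [← ContinuousLinearMap.adjoint_inner_left]
      simp only [P, Submodule.coe_sum, Submodule.coe_smul, inner_sum, real_inner_smul_right, c]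
      simp only [real_inner_comm]
    have hproj : Wᗮ.starProjection (ι.adjoint v) = ι.adjoint v - ∑ j, c j • (b j : H) := by
      rw [Submodule.starProjection_orthogonal_val, Submodule.starProjection_apply,
        ← b.sum_repr' (W.orthogonalProjectionOnto _), Submodule.coe_sum]
      simp only [Submodule.inner_orthogonalProjectionOnto_eq_of_mem_left, Submodule.coe_smul, c]
    -- `⟪v, x - ι (P x)⟫` is an almost sure limit of continuous functionals, whose images under `ι*`
    -- converge to `ι* v` minus its projection onto `W`.
    refine map_eq_gaussianReal_of_tendsto
      (f := fun k x => inner ℝ (v - ∑ j, c j • y j k) x)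
      (c := fun k => β⁻¹ * ‖ι.adjoint (v - ∑ j, c j • y j k)‖ ^ 2) (fun k => by fun_prop) ?_ ?_ ?_
    · intro k
      rw [hγ, inner_canonicalCov_self]
    · rw [hproj]
      refine Tendsto.const_mul _ (Tendsto.pow (Tendsto.norm ?_) 2)
      simp only [map_sub, map_sum, map_smul]
      exact tendsto_const_nhds.sub (tendsto_finsetSum _ fun j _ => (hy j).const_smul _)
    · filter_upwards [hL] with x hx
      rw [inner_sub_right, hvP]
      simp only [inner_sub_left, sum_inner, real_inner_smul_left]
      refine tendsto_const_nhds.sub (tendsto_finsetSum _ fun j _ => ?_)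
      rw [mul_comm]
      exact (hℓ' j x (hx j)).const_mul _

end Extension

/-! ### Independent Gaussian sequences and Gaussian series -/

/-- The law of a sequence of independent standard Gaussian variables. -/
def gaussianSeq : Measure (ℕ → ℝ) := Measure.infinitePi fun _ => gaussianReal 0 1

instance : IsProbabilityMeasure gaussianSeq := by unfold gaussianSeq; infer_instance

lemma gaussianSeq_map_eval (k : ℕ) : gaussianSeq.map (fun ω => ω k) = gaussianReal 0 1 :=
  Measure.infinitePi_map_eval _ k

lemma gaussianSeq_iIndepFun {F : Type*} [MeasurableSpace F] {f : ℕ → ℝ → F}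
    (hf : ∀ k, Measurable (f k)) : iIndepFun (fun k ω => f k (ω k)) gaussianSeq :=
  iIndepFun_infinitePi hf

lemma gaussianSeq_memLp (k : ℕ) : MemLp (fun ω => ω k) 2 gaussianSeq := by
  have h : MemLp id 2 (gaussianReal 0 1) := memLp_id_gaussianReal' 2 (by simp)
  rw [← gaussianSeq_map_eval k, memLp_map_measure_iff (f := fun ω : ℕ → ℝ => ω k) (by fun_prop)
    (measurable_pi_apply k).aemeasurable] at h
  exact h

lemma gaussianSeq_integral_eval (k : ℕ) : ∫ ω, ω k ∂gaussianSeq = 0 := by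
  have := integral_map (μ := gaussianSeq) (φ := fun ω => ω k) (f := fun x : ℝ => x)
    (measurable_pi_apply k).aemeasurable (by fun_prop)
  rw [← this, gaussianSeq_map_eval, integral_id_gaussianReal]

lemma gaussianSeq_integral_sq (k : ℕ) : ∫ ω, ω k ^ 2 ∂gaussianSeq = 1 := by
  have h1 := variance_id_gaussianReal (μ := 0) (v := 1)
  rw [variance_of_integral_eq_zero aemeasurable_id (by simp), ← gaussianSeq_map_eval k,
    integral_map (measurable_pi_apply k).aemeasurable (by fun_prop)] at h1
  simpa using h1

lemma gaussianSeq_integral_mul {i j : ℕ} (h : i ≠ j) : ∫ ω, ω i * ω j ∂gaussianSeq = 0 := by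
  have := ((gaussianSeq_iIndepFun (f := fun _ x => x) (fun _ => measurable_id)).indepFun h)
  rw [this.integral_fun_mul_eq_mul_integral
    (measurable_pi_apply i).aestronglyMeasurable (measurable_pi_apply j).aestronglyMeasurable,
    gaussianSeq_integral_eval, zero_mul]

lemma gaussianSeq_map_sum (a : ℕ → ℝ) (n : ℕ) :
    gaussianSeq.map (fun ω => ∑ k ∈ Finset.range n, ω k * a k) =
      gaussianReal 0 (∑ k ∈ Finset.range n, a k ^ 2).toNNReal := by
  induction n with
  | zero => simp [gaussianReal_zero_var]
  | succ n ih =>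
    have hind := (gaussianSeq_iIndepFun (f := fun k x => x * a k) (fun _ => by fun_prop))
    have h1 := hind.indepFun_finsetSum_of_notMem (by fun_prop)
      (s := Finset.range n) (i := n) (by simp)
    have h2 : gaussianSeq.map (fun ω => ω n * a n) = gaussianReal 0 (a n ^ 2).toNNReal := by
      have := gaussianReal_map_mul_const (μ := 0) (v := 1) (a n)
      rw [← gaussianSeq_map_eval n, Measure.map_map (by fun_prop) (by fun_prop)] at this
      simp only [Function.comp_def, mul_zero, mul_one] at this
      rw [this]
      congr 1
      exact (Real.toNNReal_of_nonneg (sq_nonneg _)).symm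
    have h3 : gaussianSeq.map (∑ k ∈ Finset.range n, fun ω : ℕ → ℝ => ω k * a k) =
        gaussianReal 0 (∑ k ∈ Finset.range n, a k ^ 2).toNNReal := by
      rw [← ih]; congr 1; ext ω; simp
    have h4 := gaussianReal_add_gaussianReal_of_indepFun h1 h3 h2
    rw [Finset.sum_range_succ, Real.toNNReal_add (Finset.sum_nonneg fun _ _ => sq_nonneg _)
      (sq_nonneg _), ← add_zero (0 : ℝ), ← h4]
    congr 1
    ext ω
    simp [Finset.sum_range_succ]

/-- A Gaussian series with square summable coefficients converges in measure, and the limit is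
Gaussian. -/
theorem exists_gaussian_series {X : Type*} [NormedAddCommGroup X] [InnerProductSpace ℝ X]
    [CompleteSpace X] [SecondCountableTopology X] [MeasurableSpace X] [BorelSpace X]
    {y : ℕ → X} (hy : Summable fun k => ‖y k‖ ^ 2) :
    ∃ S : (ℕ → ℝ) → X, Measurable S ∧
      TendstoInMeasure gaussianSeq (fun n ω => ∑ k ∈ Finset.range n, ω k • y k) atTop S ∧
      ∀ v d, HasSum (fun k => inner ℝ v (y k) ^ 2) d →
        gaussianSeq.map (fun ω => inner ℝ v (S ω)) = gaussianReal 0 d.toNNReal := by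
  have hmem : ∀ k, MemLp (fun ω : ℕ → ℝ => ω k • y k) 2 gaussianSeq := fun k =>
    
    (ContinuousLinearMap.toSpanSingleton ℝ (y k)).comp_memLp' (gaussianSeq_memLp k)
  -- Uncorrelated coordinates make the terms orthogonal in `L²`, with norms `‖y k‖`, so square
  -- summability gives convergence there.
  set u : ℕ → Lp X 2 gaussianSeq := fun k => (hmem k).toLp
  have hinner : ∀ i j, inner ℝ (u i) (u j) =
      (∫ ω, ω i * ω j ∂gaussianSeq) * inner ℝ (y i) (y j) := by
    intro i j
    rw [L2.inner_def, ← integral_mul_const]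
    refine integral_congr_ae ?_
    filter_upwards [(hmem i).coeFn_toLp, (hmem j).coeFn_toLp] with ω h1 h2
    simp only [u]
    rw [h1, h2, real_inner_smul_left, real_inner_smul_right, mul_assoc]
  have hnorm : ∀ k, ‖u k‖ ^ 2 = ‖y k‖ ^ 2 := fun k => by
    rw [← real_inner_self_eq_norm_sq, hinner, real_inner_self_eq_norm_sq]
    simp_rw [← sq]
    rw [gaussianSeq_integral_sq, one_mul]
  have hsum : Summable u := by
    have hof : OrthogonalFamily ℝ (fun k => (ℝ ∙ u k)) fun k => (ℝ ∙ u k).subtypeₗᵢ := by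
      refine OrthogonalFamily.of_pairwise fun i j hij => ?_
      rw [Function.onFun, Submodule.isOrtho_span]
      rintro _ rfl _ rfl
      rw [hinner, gaussianSeq_integral_mul hij, zero_mul]
    have := (hof.summable_iff_norm_sq_summable
      (fun k => ⟨u k, Submodule.mem_span_singleton_self _⟩)).2 (by simpa [hnorm] using hy)
    simpa using this
  obtain ⟨S, hS⟩ := hsum
  have hconv : TendstoInMeasure gaussianSeq (fun n ω => ∑ k ∈ Finset.range n, ω k • y k) atTop
      S := by
    refine (tendstoInMeasure_of_tendsto_Lp hS.tendsto_sum_nat).congr (fun n => ?_)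
      EventuallyEq.rfl
    have h1 := Lp.coeFn_finsetSum (Finset.range n) u
    have h2 : ∀ᵐ ω ∂gaussianSeq, ∀ k, u k ω = ω k • y k :=
      ae_all_iff.2 fun k => (hmem k).coeFn_toLp
    filter_upwards [h1, h2] with ω h3 h4
    rw [h3]
    simp [h4]
  refine ⟨S, (Lp.stronglyMeasurable S).measurable, hconv, fun v d hd => ?_⟩
  obtain ⟨ns, hns, hlim⟩ := hconv.exists_seq_tendsto_ae
  refine map_eq_gaussianReal_of_tendsto
    (f := fun i ω => inner ℝ v (∑ k ∈ Finset.range (ns i), ω k • y k))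
    (c := fun i => ∑ k ∈ Finset.range (ns i), inner ℝ v (y k) ^ 2) (fun k => ?_) ?_
    (hd.tendsto_sum_nat.comp hns.tendsto_atTop) ?_
  · exact (by fun_prop : Measurable fun ω : ℕ → ℝ =>
      ∑ k ∈ Finset.range (ns _), ω k • y k).const_inner.aemeasurable
  · intro i
    simp only [inner_sum, real_inner_smul_right]
    exact gaussianSeq_map_sum _ _
  · filter_upwards [hlim] with ω hω
    exact tendsto_const_nhds.inner hω

/-! ### Hilbert–Schmidt maps and existence of the canonical Gaussian measure -/

section HilbertSchmidt

variable {H X : Type*} [NormedAddCommGroup H] [InnerProductSpace ℝ H] [CompleteSpace H]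
  [NormedAddCommGroup X] [InnerProductSpace ℝ X] [CompleteSpace X]

omit [CompleteSpace H] in
lemma HilbertBasis.hasSum_inner_sq {κ : Type*} (b : HilbertBasis κ ℝ H) (x : H) :
    HasSum (fun i => inner ℝ x (b i) ^ 2) (‖x‖ ^ 2) := by
  have := b.hasSum_inner_mul_inner x x
  rw [real_inner_self_eq_norm_sq] at this
  refine this.congr_fun fun i => ?_
  rw [real_inner_comm x, sq]

omit [CompleteSpace H] in
lemma HilbertBasis.tsum_ofReal_inner_sq {κ : Type*} (b : HilbertBasis κ ℝ H) (x : H) :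
    ∑' i, ENNReal.ofReal (inner ℝ x (b i) ^ 2) = ENNReal.ofReal (‖x‖ ^ 2) := by
  have h := HilbertBasis.hasSum_inner_sq b x
  rw [← ENNReal.ofReal_tsum_of_nonneg (fun _ => sq_nonneg _) h.summable, h.tsum_eq]

/-- A Hilbert–Schmidt operator is square summable along every orthonormal family. -/
lemma IsHilbertSchmidt.summable {T : H →L[ℝ] X} (hT : IsHilbertSchmidt T) {κ : Type*} {e : κ → H}
    (he : Orthonormal ℝ e) : Summable fun k => ‖T (e k)‖ ^ 2 := by
  obtain ⟨s, b, hb⟩ := hT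
  obtain ⟨t, f, -⟩ := exists_hilbertBasis ℝ X
  -- Expand in a basis of `X`, swap sums, apply Bessel to `e` and Parseval to `b`. Extended
  -- nonnegative sums make the swaps unconditional.
  have h1 : ∑' k, ENNReal.ofReal (‖T (e k)‖ ^ 2) ≤ ∑' i, ENNReal.ofReal (‖T (b i)‖ ^ 2) := by
    calc ∑' k, ENNReal.ofReal (‖T (e k)‖ ^ 2)
        = ∑' k, ∑' j, ENNReal.ofReal (inner ℝ (T (e k)) (f j) ^ 2) := by
          simp_rw [HilbertBasis.tsum_ofReal_inner_sq f]
      _ = ∑' j, ∑' k, ENNReal.ofReal (inner ℝ (T (e k)) (f j) ^ 2) := ENNReal.tsum_comm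
      _ ≤ ∑' j, ENNReal.ofReal (‖T.adjoint (f j)‖ ^ 2) := by
          refine ENNReal.tsum_le_tsum fun j => ?_
          have hs := he.inner_products_summable (T.adjoint (f j))
          have hle := he.tsum_inner_products_le (T.adjoint (f j))
          simp_rw [← ContinuousLinearMap.adjoint_inner_right]
          simp only [Real.norm_eq_abs, sq_abs] at hs hle
          rw [← ENNReal.ofReal_tsum_of_nonneg (fun _ => sq_nonneg _) hs]
          exact ENNReal.ofReal_le_ofReal hle
      _ = ∑' j, ∑' i, ENNReal.ofReal (inner ℝ (T (b i)) (f j) ^ 2) := by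
          refine tsum_congr fun j => ?_
          rw [← HilbertBasis.tsum_ofReal_inner_sq b]
          refine tsum_congr fun i => ?_
          rw [ContinuousLinearMap.adjoint_inner_left, real_inner_comm]
      _ = ∑' i, ∑' j, ENNReal.ofReal (inner ℝ (T (b i)) (f j) ^ 2) := ENNReal.tsum_comm
      _ = ∑' i, ENNReal.ofReal (‖T (b i)‖ ^ 2) := by
          simp_rw [HilbertBasis.tsum_ofReal_inner_sq f]
  have h2 := (h1.trans_lt hb.tsum_ofReal_lt_top).ne
  exact (ENNReal.summable_toReal h2).congr fun k => ENNReal.toReal_ofReal (sq_nonneg _)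

omit [CompleteSpace H] in
-- Orthonormal vectors are at distance `√2`, so balls of radius `1/2` around them are disjoint.
lemma countable_of_orthonormal [SecondCountableTopology H] {κ : Type*} {e : κ → H}
    (he : Orthonormal ℝ e) : Countable κ := by
  rw [← Set.countable_univ_iff]
  refine Set.PairwiseDisjoint.countable_of_isOpen (s := fun k => Metric.ball (e k) (1 / 2))
    (fun i _ j _ hij => Metric.ball_disjoint_ball ?_) (fun _ _ => Metric.isOpen_ball)
    (fun k _ => ⟨e k, Metric.mem_ball_self (by norm_num)⟩)
  have h1 : ‖e i - e j‖ ^ 2 = 2 := by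
    rw [norm_sub_sq_real, he.1, he.1, he.2 hij]; norm_num
  rw [dist_eq_norm]
  nlinarith [norm_nonneg (e i - e j)]

/-- The law of the series `∑ ω_k β^(-1/2) ι(b_k)` works; Parseval applied to `ι* v` gives the
variances. -/
theorem exists_isCenteredGaussian [SecondCountableTopology H] [SecondCountableTopology X]
    [MeasurableSpace X] [BorelSpace X] {ι : H →L[ℝ] X} (hι : IsHilbertSchmidt ι) {β : ℝ}
    (hβ : 0 < β) : ∃ γ : Measure X, IsCenteredGaussian (canonicalCov ι β) γ := by
  obtain ⟨s, b, -⟩ := exists_hilbertBasis ℝ H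
  have := countable_of_orthonormal b.orthonormal
  have := Encodable.ofCountable s
  have hinj : Function.Injective (Encodable.encode : s → ℕ) := Encodable.encode_injective
  -- The basis may be finite, so it is encoded into `ℕ` and padded with zeros.
  set y : ℕ → X := Function.extend (Encodable.encode : s → ℕ) (fun i => √β⁻¹ • ι (b i)) 0
  have hy1 : ∀ i : s, y (Encodable.encode i) = √β⁻¹ • ι (b i) := fun i => hinj.extend_apply _ _ i
  have hy2 : ∀ n ∉ Set.range (Encodable.encode : s → ℕ), y n = 0 := fun n hn =>
    Function.extend_apply' _ _ _ hn
  have hsq : √β⁻¹ ^ 2 = β⁻¹ := Real.sq_sqrt (by positivity)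
  have hsum : Summable fun n => ‖y n‖ ^ 2 := by
    rw [← hinj.summable_iff (fun n hn => by simp [hy2 n hn])]
    refine ((hι.summable b.orthonormal).mul_left β⁻¹).congr fun i => ?_
    simp only [Function.comp, hy1, norm_smul, mul_pow, Real.norm_eq_abs, sq_abs, hsq]
  obtain ⟨S, hS, -, hlaw⟩ := exists_gaussian_series hsum
  refine ⟨gaussianSeq.map S, fun v => ?_⟩
  rw [Measure.map_map (by fun_prop) hS, inner_canonicalCov_self]
  refine hlaw v _ ?_
  rw [← hinj.hasSum_iff (fun n hn => by simp [hy2 n hn])]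
  refine ((HilbertBasis.hasSum_inner_sq b (ι.adjoint v)).mul_left β⁻¹).congr_fun fun i => ?_
  simp only [Function.comp, hy1, real_inner_smul_right, mul_pow, hsq,
    ContinuousLinearMap.adjoint_inner_left]

end HilbertSchmidt

/-! ### Orthonormal sequences adapted to the exhausting subspaces -/

section AdaptedBasis

variable {H : Type*} [NormedAddCommGroup H] [InnerProductSpace ℝ H]

/-- An increasing sequence of subspaces of dimensions `0, 1, 2, …` has an adapted orthonormal
sequence. -/
lemma exists_adapted_orthonormal {Ξ : ℕ → Submodule ℝ H} [∀ n, FiniteDimensional ℝ (Ξ n)]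
    (hdim : ∀ n, Module.finrank ℝ (Ξ n) = n) (hmono : Monotone Ξ) :
    ∃ e : ℕ → H, Orthonormal ℝ e ∧ ∀ n k, k < n → e k ∈ Ξ n := by
  have h : ∀ k, ∃ x : H, ‖x‖ = 1 ∧ x ∈ Ξ (k + 1) ∧ x ∈ (Ξ k)ᗮ := by
    intro k
    -- If this intersection were trivial, `Ξ k` and `Ξ (k + 1)` would coincide, contradicting their
    -- dimensions.
    have hne : (Ξ k)ᗮ ⊓ Ξ (k + 1) ≠ ⊥ := by
      intro h0
      have h1 := Submodule.sup_orthogonal_inf_of_hasOrthogonalProjection (hmono (Nat.le_succ k))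
      rw [h0, sup_bot_eq] at h1
      have h2 := hdim (k + 1)
      rw [← h1, hdim] at h2
      omega
    obtain ⟨x, hx, hx0⟩ := Submodule.exists_mem_ne_zero_of_ne_bot hne
    exact ⟨‖x‖⁻¹ • x, norm_smul_inv_norm hx0, Submodule.smul_mem _ _ hx.2,
      Submodule.smul_mem _ _ hx.1⟩
  choose e he1 he2 he3 using h
  have hmem : ∀ n k, k < n → e k ∈ Ξ n := fun n k hk => hmono (Nat.succ_le_of_lt hk) (he2 k)
  have hort : ∀ i j, i < j → inner ℝ (e i) (e j) = (0 : ℝ) := fun i j hij =>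
    Submodule.inner_right_of_mem_orthogonal (hmem j i hij) (he3 j)
  refine ⟨e, ⟨he1, fun i j hij => ?_⟩, hmem⟩
  rcases lt_or_gt_of_ne hij with h | h
  · exact hort i j h
  · rw [real_inner_comm]; exact hort j i h

/-- The orthonormal basis of the `n`-th subspace given by an adapted orthonormal sequence. -/
def adaptedBasis {K : Submodule ℝ H} [FiniteDimensional ℝ K] {n : ℕ}
    (hdim : Module.finrank ℝ K = n) {e : ℕ → H} (he : Orthonormal ℝ e)
    (hmem : ∀ k, k < n → e k ∈ K) : OrthonormalBasis (Fin n) ℝ K :=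
  have hon : Orthonormal ℝ fun i : Fin n => (⟨e i, hmem i i.2⟩ : K) :=
    (LinearIsometry.orthonormal_comp_iff K.subtypeₗᵢ).1
      (he.comp (fun i : Fin n => (i : ℕ)) Fin.val_injective)
  OrthonormalBasis.mk hon
    (hon.linearIndependent.span_eq_top_of_card_eq_finrank' (by simp [hdim])).ge

lemma adaptedBasis_apply {K : Submodule ℝ H} [FiniteDimensional ℝ K] {n : ℕ}
    (hdim : Module.finrank ℝ K = n) {e : ℕ → H} (he : Orthonormal ℝ e)
    (hmem : ∀ k, k < n → e k ∈ K) (i : Fin n) : (adaptedBasis hdim he hmem i : H) = e i := by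
  simp [adaptedBasis]

/-- The partial sums are the squared norms of the projections onto `Ξ n`, which converge to the
projection onto the closure of the union. -/
lemma hasSum_inner_sq_adapted [CompleteSpace H] {Ξ : ℕ → Submodule ℝ H}
    [∀ n, FiniteDimensional ℝ (Ξ n)]
    (hdim : ∀ n, Module.finrank ℝ (Ξ n) = n) (hmono : Monotone Ξ) {e : ℕ → H}
    (he : Orthonormal ℝ e) (hmem : ∀ n k, k < n → e k ∈ Ξ n) {K : Submodule ℝ H}
    [K.HasOrthogonalProjection] (hK : (⨆ n, Ξ n).topologicalClosure = K) (x : H) :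
    HasSum (fun k => inner ℝ x (e k) ^ 2) (‖K.starProjection x‖ ^ 2) := by
  subst hK
  rw [hasSum_iff_tendsto_nat_of_nonneg (fun _ => sq_nonneg _)]
  refine (((Submodule.starProjection_tendsto_closure_iSup Ξ hmono x).norm).pow 2).congr fun n => ?_
  set b := adaptedBasis (hdim n) he (hmem n)
  rw [Submodule.starProjection_apply, Submodule.norm_coe, ← b.sum_sq_norm_inner_right,
    ← Fin.sum_univ_eq_sum_range (fun k => inner ℝ x (e k) ^ 2)]
  refine Finset.sum_congr rfl fun i _ => ?_
  rw [Submodule.inner_orthogonalProjectionOnto_eq_of_mem_left, adaptedBasis_apply,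
    Real.norm_eq_abs, sq_abs, real_inner_comm]

end AdaptedBasis

/-! ### Spherical laws realized by a single Gaussian sequence -/

section StandardGaussian

variable {E : Type*} [NormedAddCommGroup E] [InnerProductSpace ℝ E] [FiniteDimensional ℝ E]
  [MeasurableSpace E] [BorelSpace E] {n : ℕ}

/-- The Gaussian vector in `E` whose coordinates in the basis `b` are the first terms of a
sequence. -/
def gaussianVector (b : OrthonormalBasis (Fin n) ℝ E) (ω : ℕ → ℝ) : E := ∑ i : Fin n, ω i • b i

lemma measurable_gaussianVector (b : OrthonormalBasis (Fin n) ℝ E) :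
    Measurable (gaussianVector b) := by
  unfold gaussianVector; fun_prop

/-- Realizes all dimensions on one probability space, so that almost sure limits in `n` make sense.
-/
lemma map_gaussianVector (b : OrthonormalBasis (Fin n) ℝ E) :
    gaussianSeq.map (gaussianVector b) = stdGaussian E := by
  rw [stdGaussian_eq_map_pi_orthonormalBasis b, ← Measure.infinitePi_eq_pi,
    ← Measure.map_infinitePi_infinitePi_of_inj (P := fun _ : ℕ => gaussianReal 0 1)
      (f := fun i : Fin n => (i : ℕ)) Fin.val_injective,
    Measure.map_map (by fun_prop) (by fun_prop)]
  rfl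

omit [MeasurableSpace E] [BorelSpace E] [FiniteDimensional ℝ E] in
lemma norm_gaussianVector (b : OrthonormalBasis (Fin n) ℝ E) (ω : ℕ → ℝ) :
    ‖gaussianVector b ω‖ = √(∑ k ∈ Finset.range n, ω k ^ 2) := by
  rw [← Real.sqrt_sq (norm_nonneg _), ← b.sum_sq_norm_inner_right, gaussianVector,
    ← Fin.sum_univ_eq_sum_range (fun k => ω k ^ 2)]
  congr 1
  refine Finset.sum_congr rfl fun i _ => ?_
  rw [b.orthonormal.inner_right_fintype, Real.norm_eq_abs, sq_abs]

end StandardGaussian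

lemma gaussianSeq_strong_law :
    ∀ᵐ ω : ℕ → ℝ ∂gaussianSeq,
      Tendsto (fun n : ℕ => (∑ k ∈ Finset.range n, ω k ^ 2) / (n : ℝ)) atTop (𝓝 1) := by
  have h := strong_law_ae_real (μ := gaussianSeq) (fun k ω => ω k ^ 2)
    (gaussianSeq_memLp 0).integrable_sq
    (fun i j hij => (gaussianSeq_iIndepFun (f := fun _ x => x ^ 2) (fun _ => by fun_prop)).indepFun
      hij)
    (fun i => by
      have h1 : IdentDistrib (fun ω : ℕ → ℝ => ω i) (fun ω => ω 0) gaussianSeq gaussianSeq :=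
        ⟨(measurable_pi_apply i).aemeasurable, (measurable_pi_apply 0).aemeasurable, by
          rw [gaussianSeq_map_eval, gaussianSeq_map_eval]⟩
      exact h1.comp (u := fun x => x ^ 2) (by fun_prop))
  simpa only [gaussianSeq_integral_sq] using h

/-- The squared radius is `n/β + 2e`; the shift `e` is negligible against `n`, so the limit does not
depend on it. -/
lemma tendsto_radius_div {β : ℝ} (e : ℝ) {s : ℕ → ℝ} (hs : ∀ n, 0 ≤ s n)
    (h : Tendsto (fun n : ℕ => s n / n) atTop (𝓝 1)) :
    Tendsto (fun n : ℕ => √(2 * (n / (2 * β) + e)) * (√(s n))⁻¹) atTop (𝓝 √β⁻¹) := by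
  have h1 : Tendsto (fun n : ℕ => (β⁻¹ + 2 * e / (n : ℝ)) / (s n / n)) atTop
      (𝓝 ((β⁻¹ + 0) / 1)) :=
    (tendsto_const_nhds.add (tendsto_const_div_atTop_nhds_zero_nat _)).div h one_ne_zero
  rw [add_zero, div_one] at h1
  refine ((Real.continuous_sqrt.tendsto _).comp h1).congr' ?_
  filter_upwards [eventually_ge_atTop 1] with n hn
  have hn0 : (n : ℝ) ≠ 0 := by positivity
  rw [← div_eq_mul_inv, ← Real.sqrt_div' _ (hs n), Function.comp]
  congr 1
  field_simp

/-- The normalized microcanonical measure is the law of a Gaussian vector projected to the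
sphere. -/
theorem normalized_microcanonical_eq {E : Type*} [NormedAddCommGroup E] [InnerProductSpace ℝ E]
    [FiniteDimensional ℝ E] [MeasurableSpace E] [BorelSpace E] {n : ℕ} (hn : 1 ≤ n)
    (b : OrthonormalBasis (Fin n) ℝ E) {β e : ℝ} (h : 0 < n / (2 * β) + e) :
    microcanonical E β n e Set.univ = ENNReal.ofReal (shellMass n (n / (2 * β) + e)) ∧
    (microcanonical E β n e Set.univ)⁻¹ • microcanonical E β n e = gaussianSeq.map fun ω =>
      (√(2 * (n / (2 * β) + e)) * (√(∑ k ∈ Finset.range n, ω k ^ 2))⁻¹) • gaussianVector b ω := by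
  have hdim : Module.finrank ℝ E = n := by
    rw [Module.finrank_eq_card_basis b.toBasis, Fintype.card_fin]
  have : Nontrivial E := Module.nontrivial_of_finrank_pos (R := ℝ) (by omega)
  have hprob : IsProbabilityMeasure ((uniformSphere E).map
      fun x => √(2 * (n / (2 * β) + e)) • x) := Measure.isProbabilityMeasure_map (by fun_prop)
  have hmass : microcanonical E β n e Set.univ =
      ENNReal.ofReal (shellMass n (n / (2 * β) + e)) := by
    rw [microcanonical_eq h, Measure.smul_apply, measure_univ, smul_eq_mul, mul_one, hdim]
  refine ⟨hmass, ?_⟩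
  have hpos : ENNReal.ofReal (shellMass n (n / (2 * β) + e)) ≠ 0 := by
    simpa using shellMass_pos hn h
  rw [hmass, microcanonical_eq h, hdim, smul_smul, ENNReal.inv_mul_cancel hpos ENNReal.ofReal_ne_top,
    one_smul, ← map_normalize_stdGaussian, ← map_gaussianVector b,
    Measure.map_map (by fun_prop) (measurable_gaussianVector b),
    Measure.map_map (by fun_prop) (by
      exact (by fun_prop : Measurable fun x : E => ‖x‖⁻¹ • x).comp (measurable_gaussianVector b))]
  congr 1
  ext1 ω
  simp only [Function.comp, norm_gaussianVector, smul_smul]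

/-- If `S n → S` in measure and `ρ n → c` almost surely, then `ρ n • S n → c • S` in law. -/
theorem tendsto_integral_smul {Ω X : Type*} {mΩ : MeasurableSpace Ω} {μ : Measure Ω}
    [IsProbabilityMeasure μ] [NormedAddCommGroup X] [NormedSpace ℝ X] [MeasurableSpace X]
    [BorelSpace X] [SecondCountableTopology X] {S : ℕ → Ω → X} {T : Ω → X} {ρ : ℕ → Ω → ℝ} {c : ℝ}
    (hSm : ∀ n, Measurable (S n)) (hρm : ∀ n, Measurable (ρ n)) (hS : TendstoInMeasure μ S atTop T)
    (hρ : ∀ᵐ ω ∂μ, Tendsto (fun n => ρ n ω) atTop (𝓝 c)) (φ : BoundedContinuousFunction X ℝ) :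
    Tendsto (fun n => ∫ ω, φ (ρ n ω • S n ω) ∂μ) atTop (𝓝 (∫ ω, φ (c • T ω) ∂μ)) := by
  -- Every subsequence has a further one along which convergence is almost sure, and there dominated
  -- convergence applies.
  refine tendsto_of_subseq_tendsto fun ns hns => ?_
  have hS' : TendstoInMeasure μ (fun i => S (ns i)) atTop T := fun ε hε => (hS ε hε).comp hns
  obtain ⟨ms, hms, hlim⟩ := hS'.exists_seq_tendsto_ae
  refine ⟨ms, tendsto_integral_of_dominated_convergence (fun _ => ‖φ‖) (fun i => ?_)
    (integrable_const _) (fun i => ae_of_all _ fun ω => φ.norm_coe_le_norm _) ?_⟩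
  · exact (φ.continuous.measurable.comp ((hρm _).smul (hSm _))).aestronglyMeasurable
  · filter_upwards [hlim, hρ] with ω h1 h2
    exact (φ.continuous.tendsto _).comp
      ((h2.comp (hns.comp hms.tendsto_atTop)).smul h1)

/-! ### Equivalence of ensembles and the theorem -/

section Limit

variable {H X : Type*} [NormedAddCommGroup H] [InnerProductSpace ℝ H] [CompleteSpace H]
  [MeasurableSpace H] [BorelSpace H]
  [NormedAddCommGroup X] [InnerProductSpace ℝ X] [CompleteSpace X]
  [SecondCountableTopology X] [MeasurableSpace X] [BorelSpace X]

lemma eventually_energy_pos {β : ℝ} (hβ : 0 < β) (e : ℝ) :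
    ∀ᶠ n : ℕ in atTop, 1 ≤ n ∧ 0 < (n : ℝ) / (2 * β) + e := by
  have : Tendsto (fun n : ℕ => (n : ℝ) / (2 * β) + e) atTop atTop :=
    tendsto_atTop_add_const_right _ _
      (tendsto_natCast_atTop_atTop.atTop_div_const (by positivity))
  exact (eventually_ge_atTop 1).and (this.eventually_gt_atTop 0)

/-- Equivalence of ensembles: the normalized microcanonical measures converge narrowly to the
centered Gaussian measure with variances `β⁻¹ ‖Q ι* v‖²`, where `Q` is the projection onto the
closure `K` of the union of the subspaces. -/
theorem tendsto_integral_microcanonical {ι : H →L[ℝ] X} (hHS : IsHilbertSchmidt ι)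
    {Ξ : ℕ → Submodule ℝ H} [∀ n, FiniteDimensional ℝ (Ξ n)]
    (hdim : ∀ n, Module.finrank ℝ (Ξ n) = n) (hmono : Monotone Ξ) {K : Submodule ℝ H}
    [K.HasOrthogonalProjection] (hK : (⨆ n, Ξ n).topologicalClosure = K) {β : ℝ} (hβ : 0 < β)
    (e : ℝ) {ν : Measure X} [IsFiniteMeasure ν]
    (hν : ∀ v : X, ν.map (fun x => inner ℝ v x) =
      gaussianReal 0 (β⁻¹ * ‖K.starProjection (ι.adjoint v)‖ ^ 2).toNNReal)
    (φ : BoundedContinuousFunction X ℝ) :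
    Tendsto (fun n : ℕ => ∫ x, φ x ∂((microcanonical (Ξ n) β n e Set.univ)⁻¹ •
      (microcanonical (Ξ n) β n e).map fun ξ : Ξ n => ι (ξ : H))) atTop (𝓝 (∫ x, φ x ∂ν)) := by
  obtain ⟨f, hf, hmem⟩ := exists_adapted_orthonormal hdim hmono
  obtain ⟨S, hSm, hS, hlaw⟩ := exists_gaussian_series (hHS.summable hf)
  -- The limit of the series is identified with `ν` by its one-dimensional variances.
  have hSν : gaussianSeq.map (fun ω => √β⁻¹ • S ω) = ν := by
    have : IsFiniteMeasure (gaussianSeq.map (fun ω => √β⁻¹ • S ω)) :=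
      Measure.isFiniteMeasure_map _ _
    refine ext_of_map_inner fun v => ?_
    rw [hν, Measure.map_map (by fun_prop) (by fun_prop)]
    have h1 := hasSum_inner_sq_adapted hdim hmono hf hmem hK (ι.adjoint v)
    have h2 := hlaw (√β⁻¹ • v) (β⁻¹ * ‖K.starProjection (ι.adjoint v)‖ ^ 2) (by
      refine (h1.mul_left β⁻¹).congr_fun fun k => ?_
      rw [real_inner_smul_left, mul_pow, Real.sq_sqrt (by positivity),
        ContinuousLinearMap.adjoint_inner_left])
    rw [← h2]
    congr 1
    ext1 ω
    simp only [Function.comp, real_inner_smul_left, real_inner_smul_right]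
  have hlim := tendsto_integral_smul (μ := gaussianSeq) (c := √β⁻¹)
    (ρ := fun n ω => √(2 * (n / (2 * β) + e)) * (√(∑ k ∈ Finset.range n, ω k ^ 2))⁻¹)
    (fun n => by fun_prop) (fun n => by fun_prop) hS
    (gaussianSeq_strong_law.mono fun ω hω =>
      tendsto_radius_div e (fun n => Finset.sum_nonneg fun _ _ => sq_nonneg _) hω) φ
  rw [← hSν, integral_map (by fun_prop) φ.continuous.aestronglyMeasurable]
  refine hlim.congr' ?_
  filter_upwards [eventually_energy_pos hβ e] with n hn
  set b := adaptedBasis (hdim n) hf (hmem n)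
  have hG : Measurable (gaussianVector b) := measurable_gaussianVector b
  have hι : Measurable fun ξ : Ξ n => ι (ξ : H) := by fun_prop
  rw [← Measure.map_smul, (normalized_microcanonical_eq hn.1 b hn.2).2,
    Measure.map_map hι (by fun_prop), integral_map (by fun_prop) φ.continuous.aestronglyMeasurable]
  refine integral_congr_ae (ae_of_all _ fun ω => ?_)
  simp only [Function.comp, gaussianVector, Submodule.coe_smul, Submodule.coe_sum, map_smul,
    map_sum, b, adaptedBasis_apply]
  rw [Fin.sum_univ_eq_sum_range (fun k => ω k • ι (f k))]

end Limit

end Microcanonical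

end

open Microcanonical in
theorem lemmal :
    ∃ C : ℝ → ℕ → ℝ,
      (∀ β : ℝ, 0 < β → β < 2 * Real.pi * Real.exp 1 → Tendsto (C β) atTop atTop) ∧
      (∀ β : ℝ, 2 * Real.pi * Real.exp 1 ≤ β → Tendsto (C β) atTop atBot) ∧
      ∀ (H X : Type*)
        [NormedAddCommGroup H] [InnerProductSpace ℝ H] [CompleteSpace H]
        [SecondCountableTopology H] [MeasurableSpace H] [BorelSpace H]
        [NormedAddCommGroup X] [InnerProductSpace ℝ X] [CompleteSpace X]
        [SecondCountableTopology X] [MeasurableSpace X] [BorelSpace X]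
        -- the embedding of `H` into `X`
        (ι : H →L[ℝ] X) (_ : Function.Injective ι) (_ : DenseRange ι) (_ : IsHilbertSchmidt ι)
        -- the finite-dimensional subspace `W` and the exhausting subspaces of `Wᗮ`
        (W : Submodule ℝ H) [FiniteDimensional ℝ W]
        (Ξ : ℕ → Submodule ℝ H) [∀ n, FiniteDimensional ℝ (Ξ n)]
        (_ : ∀ n, Module.finrank ℝ (Ξ n) = n) (_ : Monotone Ξ)
        (_ : (⨆ n, Ξ n).topologicalClosure = Wᗮ)
        (β e : ℝ) (_ : 0 < β),
        -- the microcanonical measures exist, with finite positive total mass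
        (∀ n : ℕ, 1 ≤ n → 0 < n / (2 * β) + e →
          IsDelta (fun ξ : Ξ n => ‖ξ‖ ^ 2 / 2) (n / (2 * β) + e) (microcanonical (Ξ n) β n e) ∧
          0 < microcanonical (Ξ n) β n e Set.univ ∧
          microcanonical (Ξ n) β n e Set.univ < ⊤) ∧
        -- asymptotics of the total mass
        Tendsto (fun n : ℕ => Real.log (microcanonical (Ξ n) β n e Set.univ).toReal - C β n)
          atTop (𝓝 (β * e)) ∧
        -- narrow convergence on `X` of the normalized measures to the push-forward under
        -- `id - P̂` of the canonical Gaussian measure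
        (∃ γ : Measure X, IsCenteredGaussian (canonicalCov ι β) γ) ∧
        ∀ γ : Measure X, IsCenteredGaussian (canonicalCov ι β) γ →
          (∃ P : X → W, IsMeasurableLinearExtension ι γ W.orthogonalProjectionOnto P) ∧
          ∀ P : X → W, IsMeasurableLinearExtension ι γ W.orthogonalProjectionOnto P →
            IsProbabilityMeasure (γ.map fun x => x - ι (P x)) ∧
            ∀ φ : BoundedContinuousFunction X ℝ,
              Tendsto
                (fun n : ℕ => ∫ x, φ x ∂((microcanonical (Ξ n) β n e Set.univ)⁻¹ •
                  (microcanonical (Ξ n) β n e).map fun ξ : Ξ n => ι (ξ : H)))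
                atTop (𝓝 (∫ x, φ x ∂(γ.map fun x => x - ι (P x)))) := by
  -- The normalization is the log-mass at `e = 0`, which involves only `β` and `n`.
  refine ⟨logMass, fun β h0 h => tendsto_logMass_atTop h0 h, fun β h => tendsto_logMass_atBot h, ?_⟩
  intro H X _ _ _ _ _ _ _ _ _ _ _ _ ι hinj _ hHS W _ Ξ _ hdim hmono hcl β e hβ
  obtain ⟨f, hf, hmem⟩ := exists_adapted_orthonormal hdim hmono
  have hmass : ∀ n : ℕ, 1 ≤ n → 0 < n / (2 * β) + e → microcanonical (Ξ n) β n e Set.univ =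
      ENNReal.ofReal (shellMass n (n / (2 * β) + e)) := fun n hn h =>
    (normalized_microcanonical_eq hn (adaptedBasis (hdim n) hf (hmem n)) h).1
  refine ⟨fun n hn h => ⟨?_, ?_, ?_⟩, ?_, exists_isCenteredGaussian hHS hβ, fun γ hγ => ?_⟩
  · have : Nontrivial (Ξ n) := Module.nontrivial_of_finrank_pos (R := ℝ) (by rw [hdim]; omega)
    rw [microcanonical_eq h]
    exact isDelta_uniformSphere h
  · rw [hmass n hn h]
    exact ENNReal.ofReal_pos.2 (shellMass_pos hn h)
  · rw [hmass n hn h]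
    exact ENNReal.ofReal_lt_top
  · refine (tendsto_log_shellMass_sub hβ e).congr' ?_
    filter_upwards [eventually_energy_pos hβ e] with n hn
    rw [hmass n hn.1 hn.2, ENNReal.toReal_ofReal (shellMass_pos hn.1 hn.2).le]
  · have hprob := hγ.isProbabilityMeasure
    obtain ⟨P₀, hP₀, hlaw⟩ := exists_isMeasurableLinearExtension hγ hβ hinj W
    refine ⟨⟨P₀, hP₀⟩, fun P hP => ?_⟩
    have hPm : AEMeasurable (fun x => x - ι (P x)) γ := by
      have := hP.nullMeasurable.aemeasurable
      fun_prop
    have hPprob : IsProbabilityMeasure (γ.map fun x => x - ι (P x)) :=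
      Measure.isProbabilityMeasure_map hPm
    refine ⟨hPprob, tendsto_integral_microcanonical hHS hdim hmono hcl hβ e fun v => ?_⟩
    -- The marginals are known for the constructed `P₀`; almost sure uniqueness transfers them to
    -- `P`.
    rw [AEMeasurable.map_map_of_aemeasurable (by fun_prop) hPm, ← hlaw v]
    refine Measure.map_congr ?_
    filter_upwards [hP.ae_eq hγ hβ hP₀] with x hx
    simp [hx]
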